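/- Notation. Let $n\ge 1$, $s\in(0,1)$, $k\in\mathbb N=\{0,1,2,\dots\}$, $\alpha\in[0,1)$, and write $B_r=\{x\in\mathbb R^n:|x|<r\}$, $Q_r=B_r\times(-r^2,0]$, $\widetilde Q_r=B_r\times(-r^2,r^2)$. For $\sigma\in\mathbb N^{n+1}$ put $|\sigma|=\sigma_1+\dots+\sigma_n+2\sigma_{n+1}$ and let $\mathcal P_k$ be the space of parabolic polynomials $P(x,t)=\sum_{|\sigma|\le k}\frac{a_\sigma}{\sigma!}\,x_1^{\sigma_1}\cdots x_n^{\sigma_n}t^{\sigma_{n+1}}$ with $a_\sigma\in\mathbb R$; let $\|P\|=\sum_{|\sigma|\le k}|D^\sigma P(0,0)|=\sum_{|\sigma|\le k}|a_\sigma|$. Function spaces. Let $f$ be a real function, measurable on $Q_{r_0}$. For a polynomial $P$ let $\nu_f(R)=\sup_{0<r\le R}\frac1{|Q_r|}\int_{Q_r}|f-P|\,dx\,dt$. We say that $f\in C_1^{k+\alpha}(0,0;r_0)$ if there are $K\ge 0$ and $P\in\mathcal P_k$ such that for all $r\in[1/4,1/2]$ and all integers $m\ge1$ $$\sum_{i=0}^{m-1}(r_0r^i)^{-(k+\alpha)}\,\nu_f(r_0r^i)\le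 Km .$$ The spaces $C_1^{k+\alpha,\ln}(0,0;r_0)$ and $C_1^{k+\alpha,Dini}(0,0;r_0)$ are defined in the same way, with $Km$ replaced by $Km^2$, respectively with the condition $\sum_{i=0}^{\infty}(r_0r^i)^{-(k+\alpha)}\nu_f(r_0r^i)\le K$ for all $r\in[1/4,1/2]$. We say that $f\in C_1^{k,x\text{-}\ln}(0,0;r_0)$ if there are $K\ge0$ and $P\in\mathcal P_k$ such that for all $(x,t)\in Q_{r_0}$ with $x\ne0$ and $r:=(|x|^2+|t|)^{1/2}\le r_0$ $$\frac1{|Q_r|}\int_{Q_r}|f-P|\,dy\,d\tau\le K\,r^k\max\{1,|\ln|x||\}.$$ In each space the norm is the infimum of $K+\|P\|$ over all admissible pairs $(K,P)$. Internal part. Let $K_{-s}(x,t)=C_{n,s}\,t^{-\frac n2-1+s}e^{-|x|^2/(4t)}$ for $t>0$, where $C_{n,s}=\big((4\pi)^{n/2}|\Gamma(-s)|\big)^{-1}$, and $$w_1(x,t)=\int_{-\infty}^t\int_{\mathbb R^n}(f\chi_{\widetilde Q_1})(y,\tau)\,K_{-s}(x-y,t-\tau)\,dy\,d\tau .$$ Proposition.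 There is a constant $C=C(n,k,\alpha,s)>0$ such that for every $f:\mathbb R^n\times\mathbb R\to[0,\infty)$ with $f\in C_1^{k+\alpha}(0,0;1)$ the integral defining $w_1$ converges at almost every point of $Q_{1/2}$, and: (a) if $2s+\alpha\notin\mathbb Z$, then $w_1\in C_1^{k+\alpha+2s}(0,0;\tfrac12)$ and $\|w_1\|_{C_1^{k+\alpha+2s}(0,0;1/2)}\le C\|f\|_{C_1^{k+\alpha}(0,0;1)}$; here the polynomials have degree at most $\lfloor k+\alpha+2s\rfloor$ and the exponent in the series is $k+\alpha+2s$; (b) if $2s+\alpha\in\mathbb Z$ and $k+\alpha+2s$ is odd, then $w_1\in C_1^{k+\alpha+2s,\,x\text{-}\ln}(0,0;\tfrac12)$ and $\|w_1\|_{C_1^{k+\alpha+2s,x\text{-}\ln}(0,0;1/2)}\le C\|f\|_{C_1^{k+\alpha}(0,0;1)}$; if $2s+\alpha\in\mathbb Z$ and $k+\alpha+2s$ is even, then $w_1\in C_1^{k+\alpha+2s,\ln}(0,0;\tfrac12)$ and $\|w_1\|_{C_1^{k+\alpha+2s,\ln}(0,0;1/2)}\le C\|f\|_{C_1^{k+\alpha}(0,0;1)}$.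 Furthermore, if $f\in C_1^{k+\alpha,Dini}(0,0;1)$, then (whether or not $2s+\alpha$ is an integer) $w_1\in C_1^{k+\alpha+2s}(0,0;\tfrac12)$ and $\|w_1\|_{C_1^{k+\alpha+2s}(0,0;1/2)}\le C\|f\|_{C_1^{k+\alpha,Dini}(0,0;1)}$. -/

import Mathlib

open MeasureTheory Set
open scoped ENNReal Nat

noncomputable section

namespace FracHeat

/-- Space-time `ℝⁿ × ℝ`, with the Euclidean norm on `ℝⁿ` and Lebesgue measure. -/
abbrev SpaceTime (n : ℕ) : Type := EuclideanSpace ℝ (Fin n) × ℝ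

/-- The backward parabolic cylinder `Q_r = B_r × (-r², 0]` at the origin. -/
def Q (n : ℕ) (r : ℝ) : Set (SpaceTime n) :=
  Metric.ball (0 : EuclideanSpace ℝ (Fin n)) r ×ˢ Ioc (-(r ^ 2)) 0

/-- The two-sided parabolic cylinder `Q̃_r = B_r × (-r², r²)` at the origin. -/
def Qtilde (n : ℕ) (r : ℝ) : Set (SpaceTime n) :=
  Metric.ball (0 : EuclideanSpace ℝ (Fin n)) r ×ˢ Ioo (-(r ^ 2)) (r ^ 2)

/-- The space-time multi-indices `σ = (σ₁, …, σₙ, σₙ₊₁)` of parabolic length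
`|σ| = σ₁ + ⋯ + σₙ + 2 σₙ₊₁ ≤ k`; see `mem_multiIndices`. -/
def multiIndices (n k : ℕ) : Finset ((Fin n → ℕ) × ℕ) :=
  ((Fintype.piFinset fun _ : Fin n => Finset.range (k + 1)) ×ˢ Finset.range (k + 1)).filter
    fun σ => ∑ i, σ.1 i + 2 * σ.2 ≤ k

theorem mem_multiIndices {n k : ℕ} {σ : (Fin n → ℕ) × ℕ} :
    σ ∈ multiIndices n k ↔ ∑ i, σ.1 i + 2 * σ.2 ≤ k := by
  simp only [multiIndices, Finset.mem_filter, Finset.mem_product, Fintype.mem_piFinset,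
    Finset.mem_range, and_iff_right_iff_imp]
  intro h
  refine ⟨fun i => ?_, by omega⟩
  have : σ.1 i ≤ ∑ j, σ.1 j :=
    Finset.single_le_sum (f := σ.1) (fun _ _ => Nat.zero_le _) (Finset.mem_univ i)
  omega

/-- The parabolic polynomial `P(x,t) = ∑_{|σ| ≤ k} (a_σ / σ!) (x,t)^σ` of degree at most `k`. Its
coefficients are its derivatives at the origin: `a_σ = D^σ P(0,0)`. -/
def parabolicPoly {n : ℕ} (k : ℕ) (a : (Fin n → ℕ) × ℕ → ℝ) (z : SpaceTime n) : ℝ :=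
  ∑ σ ∈ multiIndices n k,
    a σ / (((∏ i, (σ.1 i)!) * (σ.2)! : ℕ) : ℝ) * ((∏ i, z.1 i ^ σ.1 i) * z.2 ^ σ.2)

/-- The norm `‖P‖_{(0,0)} = ∑_{j ≤ k} |D^j P(0,0)| = ∑_{|σ| ≤ k} |a_σ|`. -/
def polyNorm {n : ℕ} (k : ℕ) (a : (Fin n → ℕ) × ℕ → ℝ) : ℝ :=
  ∑ σ ∈ multiIndices n k, |a σ|

/-- The average of `|f - P|` over `Q_r`, as an extended nonnegative number. -/
def meanOsc {n : ℕ} (f P : SpaceTime n → ℝ) (r : ℝ) : ℝ≥0∞ :=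
  ⨍⁻ z in Q n r, ‖f z - P z‖ₑ ∂volume

/-- `ν_f(R)`: the supremum over `0 < r ≤ R` of the averages of `|f - P|` over `Q_r`. -/
def nu {n : ℕ} (f P : SpaceTime n → ℝ) (R : ℝ) : ℝ≥0∞ :=
  ⨆ r ∈ Ioc (0 : ℝ) R, meanOsc f P r

/-- The `i`-th term `(r₀ rⁱ)^{-(k+α)} ν_f(r₀ rⁱ)` of the series measuring the regularity of `f`. -/
def seriesTerm {n : ℕ} (f P : SpaceTime n → ℝ) (k : ℕ) (α r₀ r : ℝ) (i : ℕ) : ℝ≥0∞ :=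
  ENNReal.ofReal ((r₀ * r ^ i) ^ (-((k : ℝ) + α))) * nu f P (r₀ * r ^ i)

/-- The pair (constant `K`, polynomial with coefficients `a`) is admissible for `f` in
`C₁^{k,α}(0,0;r₀)`. -/
def Adm {n : ℕ} (k : ℕ) (α r₀ : ℝ) (f : SpaceTime n → ℝ)
    (K : ℝ) (a : (Fin n → ℕ) × ℕ → ℝ) : Prop :=
  0 ≤ K ∧ ∀ r ∈ Icc (1 / 4 : ℝ) (1 / 2), ∀ m : ℕ, 1 ≤ m →
    ∑ i ∈ Finset.range m, seriesTerm f (parabolicPoly k a) k α r₀ r i ≤ ENNReal.ofReal (K * m)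

/-- Admissible pairs for `C₁^{k,α,ln}(0,0;r₀)`. -/
def AdmLn {n : ℕ} (k : ℕ) (α r₀ : ℝ) (f : SpaceTime n → ℝ)
    (K : ℝ) (a : (Fin n → ℕ) × ℕ → ℝ) : Prop :=
  0 ≤ K ∧ ∀ r ∈ Icc (1 / 4 : ℝ) (1 / 2), ∀ m : ℕ, 1 ≤ m →
    ∑ i ∈ Finset.range m, seriesTerm f (parabolicPoly k a) k α r₀ r i ≤
      ENNReal.ofReal (K * (m : ℝ) ^ 2)

/-- Admissible pairs for `C₁^{k,α,Dini}(0,0;r₀)`. -/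
def AdmDini {n : ℕ} (k : ℕ) (α r₀ : ℝ) (f : SpaceTime n → ℝ)
    (K : ℝ) (a : (Fin n → ℕ) × ℕ → ℝ) : Prop :=
  0 ≤ K ∧ ∀ r ∈ Icc (1 / 4 : ℝ) (1 / 2),
    ∑' i : ℕ, seriesTerm f (parabolicPoly k a) k α r₀ r i ≤ ENNReal.ofReal K

/-- Admissible pairs for `C₁^{k,x-ln}(0,0;r₀)`: for `(x,t) ∈ Q_{r₀}` of parabolic length
`r = (|x|² + |t|)^{1/2} ≤ r₀`, the average of `|f - P|` over `Q_r` is at most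
`K r^k max{1, |ln |x||}`. At `x = 0` the right-hand side is `+∞`, so there is no condition. -/
def AdmXLn {n : ℕ} (k : ℕ) (r₀ : ℝ) (f : SpaceTime n → ℝ)
    (K : ℝ) (a : (Fin n → ℕ) × ℕ → ℝ) : Prop :=
  0 ≤ K ∧ ∀ z ∈ Q n r₀, z.1 ≠ 0 → √(‖z.1‖ ^ 2 + |z.2|) ≤ r₀ →
    meanOsc f (parabolicPoly k a) √(‖z.1‖ ^ 2 + |z.2|) ≤
      ENNReal.ofReal (K * √(‖z.1‖ ^ 2 + |z.2|) ^ k * max 1 |Real.log ‖z.1‖|)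

/-- Membership in the pointwise space whose admissible pairs are given by `A`: `f` is measurable on
`Q_{r₀}` and has an admissible pair. -/
def Mem {n : ℕ} (A : (SpaceTime n → ℝ) → ℝ → ((Fin n → ℕ) × ℕ → ℝ) → Prop) (r₀ : ℝ)
    (f : SpaceTime n → ℝ) : Prop :=
  AEStronglyMeasurable f (volume.restrict (Q n r₀)) ∧ ∃ K a, A f K a

/-- The associated norm: the infimum of `K + ‖P‖_{(0,0)}` over the admissible pairs, where `P` has
degree at most `k`. -/
def infNorm {n : ℕ} (A : (SpaceTime n → ℝ) → ℝ → ((Fin n → ℕ) × ℕ → ℝ) → Prop) (k : ℕ)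
    (f : SpaceTime n → ℝ) : ℝ :=
  sInf {c | ∃ K a, A f K a ∧ c = K + polyNorm k a}

/-- `f ∈ C₁^{k,α}(0,0;r₀)`. -/
def MemC {n : ℕ} (k : ℕ) (α r₀ : ℝ) (f : SpaceTime n → ℝ) : Prop := Mem (Adm k α r₀) r₀ f

/-- `‖f‖` in `C₁^{k,α}(0,0;r₀)`. -/
def normC {n : ℕ} (k : ℕ) (α r₀ : ℝ) (f : SpaceTime n → ℝ) : ℝ := infNorm (Adm k α r₀) k f

/-- `f ∈ C₁^{k,α,ln}(0,0;r₀)`. -/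
def MemCLn {n : ℕ} (k : ℕ) (α r₀ : ℝ) (f : SpaceTime n → ℝ) : Prop := Mem (AdmLn k α r₀) r₀ f

/-- `‖f‖` in `C₁^{k,α,ln}(0,0;r₀)`. -/
def normCLn {n : ℕ} (k : ℕ) (α r₀ : ℝ) (f : SpaceTime n → ℝ) : ℝ := infNorm (AdmLn k α r₀) k f

/-- `f ∈ C₁^{k,α,Dini}(0,0;r₀)`. -/
def MemCDini {n : ℕ} (k : ℕ) (α r₀ : ℝ) (f : SpaceTime n → ℝ) : Prop := Mem (AdmDini k α r₀) r₀ f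

/-- `‖f‖` in `C₁^{k,α,Dini}(0,0;r₀)`. -/
def normCDini {n : ℕ} (k : ℕ) (α r₀ : ℝ) (f : SpaceTime n → ℝ) : ℝ := infNorm (AdmDini k α r₀) k f

/-- `f ∈ C₁^{k,x-ln}(0,0;r₀)`. -/
def MemCXLn {n : ℕ} (k : ℕ) (r₀ : ℝ) (f : SpaceTime n → ℝ) : Prop := Mem (AdmXLn k r₀) r₀ f

/-- `‖f‖` in `C₁^{k,x-ln}(0,0;r₀)`. -/
def normCXLn {n : ℕ} (k : ℕ) (r₀ : ℝ) (f : SpaceTime n → ℝ) : ℝ := infNorm (AdmXLn k r₀) k f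

/-- The fractional heat kernel `K_{-s}(x,t) = C_{n,s} e^{-|x|²/(4t)} / t^{n/2+1-s}` for `t > 0`, with
`C_{n,s} = 1 / ((4π)^{n/2} |Γ(-s)|)`. It is only used at `t > 0`. -/
def kernel {n : ℕ} (s : ℝ) (x : EuclideanSpace ℝ (Fin n)) (t : ℝ) : ℝ :=
  1 / ((4 * Real.pi) ^ ((n : ℝ) / 2) * |Real.Gamma (-s)|) *
    (Real.exp (-(‖x‖ ^ 2) / (4 * t)) / t ^ ((n : ℝ) / 2 + 1 - s))

/-- The integrand `(y,τ) ↦ (f χ_{Q̃₁})(y,τ) K_{-s}(x-y,t-τ)` at `z = (x,t)`. -/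
def integrand {n : ℕ} (s : ℝ) (f : SpaceTime n → ℝ) (z p : SpaceTime n) : ℝ :=
  (Qtilde n 1).indicator f p * kernel s (z.1 - p.1) (z.2 - p.2)

/-- The internal part `w₁(x,t) = ∫_{-∞}^t ∫_{ℝⁿ} (f χ_{Q̃₁})(y,τ) K_{-s}(x-y,t-τ) dy dτ`. -/
def w₁ {n : ℕ} (s : ℝ) (f : SpaceTime n → ℝ) (z : SpaceTime n) : ℝ :=
  ∫ p in univ ×ˢ Iio z.2, integrand s f z p

end FracHeat

end

/-!
The internal part `w₁` is the potential of `f χ` against the fractional heat kernel, which is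
homogeneous of degree `-γ = -(n + 2) + 2s` under the parabolic dilations and smooth away from its
pole, also across `t = 0`. The estimate is the classical one for potentials: subtract from the
kernel its parabolic Taylor polynomial at the origin.

Let `P` be the polynomial attached to `f` and `g = f - P`. The potential of `P` on the unit cylinder
is smooth near the origin (`exists_contDiff_pot_mono`), so it contributes a polynomial and a
remainder of order `N + 1`. For `g`, write `K(z - p) = T_p(z) + remainder` with `T_p` of parabolic
degree at most `N` (`exists_kernel_expansion`). Integrated over `z ∈ Q_ρ`, the remainder is at most
a multiple of `|Q_ρ| |p|^{-γ} u^N min(1, u)` with `u = ρ / |p|`: by Taylor's formula if `u ≤ 1/2`,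
and because each term separately is that small otherwise (`lintegral_remainder_le`). By Tonelli the
mean oscillation of the potential of `g` around the polynomial `∫ g(p) T_p dp` is therefore at most
a multiple of `Phi(ρ) = ∫_{Q₁} |g| |p|^{-γ} u^N min(1, u) dp` (`exists_pot_approx`), a quantity that
is monotone in `ρ`, so that the supremum over smaller radii costs nothing.

Cutting `Q₁` into the annuli of radii `r^i` bounds `Phi(r^m)` by `r^{m(k+α+2s)}` times a sum of the
terms `a_i` of the series of `f`, weighted by at most `q₁^{i-m}` for `i ≥ m` and by `q₂^{m-i}` for
`i < m`, where `q₁ = (1/2)^{k+α+2s-N}` and `q₂ = (1/2)^{N+1-k-α-2s}` (`Phi_le_dsum`). What remains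
is about sequences.
* If `k+α+2s` is not an integer and `N` is its floor, then `q₁, q₂ < 1`, and such weights preserve
  bounded Cesàro means (`sum_dsum_le`).
* Under the Dini condition the weights are at most one and the series converges (`dsum_le_tsum`).
* If `k+α+2s = N + 1`, then `q₂ = 1`, and the weighted sums at scale `r^m` are `O(m + 1)`
  (`dsum_le`). Summing over `m` gives the bound with `m²`; and since `m + 1` is comparable with the
  logarithm of the scale, and `|x|` is at most that scale, the same bound gives the logarithmic one.
  Either holds whatever the parity of `k+α+2s`.
-/

noncomputable section

namespace FracHeat

variable {n : ℕ}

instance : (volume : Measure (SpaceTime n)).IsAddHaarMeasure :=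
  inferInstanceAs
    (((volume : Measure (EuclideanSpace ℝ (Fin n))).prod (volume : Measure ℝ)).IsAddHaarMeasure)

/-! ### Parabolic scaling -/

/-- The parabolic length `max(|x|, |t|^{1/2})`. It is comparable with `(|x|² + |t|)^{1/2}`, and its
balls are exactly the cylinders `Q̃_r`. -/
def pnorm (z : SpaceTime n) : ℝ := max ‖z.1‖ √|z.2|

/-- The parabolic dilation `(x, t) ↦ (λ x, λ² t)`. -/
def dil (l : ℝ) (z : SpaceTime n) : SpaceTime n := (l • z.1, l ^ 2 * z.2)

/-- The space-time monomial `(x, t)^σ`. -/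
def mono (σ : (Fin n → ℕ) × ℕ) (z : SpaceTime n) : ℝ := (∏ i, z.1 i ^ σ.1 i) * z.2 ^ σ.2

/-- The parabolic degree `|σ|`, in which time counts twice. -/
def deg (σ : (Fin n → ℕ) × ℕ) : ℕ := ∑ i, σ.1 i + 2 * σ.2

theorem mem_multiIndices_iff_deg {k : ℕ} {σ : (Fin n → ℕ) × ℕ} :
    σ ∈ multiIndices n k ↔ deg σ ≤ k := mem_multiIndices

theorem pnorm_nonneg (z : SpaceTime n) : 0 ≤ pnorm z := le_max_of_le_left (norm_nonneg _)

theorem norm_fst_le_pnorm (z : SpaceTime n) : ‖z.1‖ ≤ pnorm z := le_max_left _ _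

theorem abs_snd_le_pnorm_sq (z : SpaceTime n) : |z.2| ≤ pnorm z ^ 2 :=
  (Real.sqrt_le_left (pnorm_nonneg z)).1 (le_max_right _ _)

theorem pnorm_pos_iff {z : SpaceTime n} : 0 < pnorm z ↔ z ≠ 0 := by
  rw [pnorm, lt_max_iff, norm_pos_iff, Real.sqrt_pos, abs_pos, Ne, Ne, Ne, Prod.ext_iff]
  simp only [Prod.fst_zero, Prod.snd_zero]
  tauto

theorem pnorm_neg (z : SpaceTime n) : pnorm (-z) = pnorm z := by simp [pnorm]

theorem pnorm_lt_iff {z : SpaceTime n} {r : ℝ} (hr : 0 < r) :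
    pnorm z < r ↔ ‖z.1‖ < r ∧ |z.2| < r ^ 2 := by
  rw [pnorm, max_lt_iff, Real.sqrt_lt' hr]

theorem mem_Q_iff {z : SpaceTime n} {r : ℝ} (hr : 0 < r) : z ∈ Q n r ↔ pnorm z < r ∧ z.2 ≤ 0 := by
  rw [pnorm_lt_iff hr, Q, mem_prod, mem_ball_zero_iff, mem_Ioc, abs_lt]
  constructor
  · rintro ⟨h1, h2, h3⟩
    exact ⟨⟨h1, h2, h3.trans_lt (by positivity)⟩, h3⟩
  · rintro ⟨⟨h1, h2, -⟩, h3⟩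
    exact ⟨h1, h2, h3⟩

theorem mem_Qtilde_iff {z : SpaceTime n} {r : ℝ} (hr : 0 < r) : z ∈ Qtilde n r ↔ pnorm z < r := by
  rw [pnorm_lt_iff hr, Qtilde, mem_prod, mem_ball_zero_iff, mem_Ioo, abs_lt]

theorem measurableSet_Q (r : ℝ) : MeasurableSet (Q n r) :=
  measurableSet_ball.prod measurableSet_Ioc

theorem measurableSet_Qtilde (r : ℝ) : MeasurableSet (Qtilde n r) :=
  measurableSet_ball.prod measurableSet_Ioo

theorem continuous_pnorm : Continuous (pnorm : SpaceTime n → ℝ) := by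
  unfold pnorm; fun_prop

theorem continuous_mono (σ : (Fin n → ℕ) × ℕ) : Continuous (mono σ : SpaceTime n → ℝ) := by
  unfold mono; fun_prop

theorem contDiff_mono (σ : (Fin n → ℕ) × ℕ) {m : WithTop ℕ∞} :
    ContDiff ℝ m (mono σ : SpaceTime n → ℝ) := by
  unfold mono; fun_prop

theorem pnorm_add_le (z w : SpaceTime n) : pnorm (z + w) ≤ pnorm z + pnorm w := by
  refine max_le ((norm_add_le _ _).trans
    (add_le_add (norm_fst_le_pnorm z) (norm_fst_le_pnorm w))) ?_
  rw [Real.sqrt_le_left (add_nonneg (pnorm_nonneg z) (pnorm_nonneg w))]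
  calc |(z + w).2| ≤ |z.2| + |w.2| := abs_add_le _ _
    _ ≤ pnorm z ^ 2 + pnorm w ^ 2 := add_le_add (abs_snd_le_pnorm_sq z) (abs_snd_le_pnorm_sq w)
    _ ≤ (pnorm z + pnorm w) ^ 2 := by nlinarith [pnorm_nonneg z, pnorm_nonneg w]

theorem pnorm_dil {l : ℝ} (hl : 0 ≤ l) (z : SpaceTime n) : pnorm (dil l z) = l * pnorm z := by
  simp only [pnorm, dil, norm_smul, Real.norm_eq_abs, abs_of_nonneg hl, abs_mul, abs_pow]
  rw [Real.sqrt_mul (by positivity), Real.sqrt_sq hl, mul_max_of_nonneg _ _ hl]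

theorem dil_sub (l : ℝ) (z w : SpaceTime n) : dil l (z - w) = dil l z - dil l w := by
  ext <;> simp [dil, mul_sub]

theorem dil_dil (l m : ℝ) (z : SpaceTime n) : dil l (dil m z) = dil (l * m) z := by
  ext
  · simp [dil, mul_assoc]
  · simp [dil]; ring

theorem dil_one (z : SpaceTime n) : dil 1 z = z := by
  ext <;> simp [dil]

theorem mono_dil (l : ℝ) (σ : (Fin n → ℕ) × ℕ) (z : SpaceTime n) :
    mono σ (dil l z) = l ^ deg σ * mono σ z := by
  simp only [mono, dil, deg, PiLp.smul_apply, smul_eq_mul, mul_pow, Finset.prod_mul_distrib,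
    Finset.prod_pow_eq_pow_sum, pow_add, pow_mul]
  ring

theorem abs_mono_le (σ : (Fin n → ℕ) × ℕ) (z : SpaceTime n) : |mono σ z| ≤ pnorm z ^ deg σ := by
  rw [mono, deg, abs_mul, Finset.abs_prod, pow_add, pow_mul, abs_pow, ← Finset.prod_pow_eq_pow_sum]
  refine mul_le_mul (Finset.prod_le_prod (fun i _ => abs_nonneg _) fun i _ => ?_)
    (pow_le_pow_left₀ (abs_nonneg _) (abs_snd_le_pnorm_sq z) _) (by positivity)
    (Finset.prod_nonneg fun i _ => pow_nonneg (pnorm_nonneg z) _)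
  rw [abs_pow]
  exact pow_le_pow_left₀ (abs_nonneg _)
    ((PiLp.norm_apply_le z.1 i).trans (norm_fst_le_pnorm z)) _

/-- In the sup norm of the product, `|z| ≤ max(1, pnorm z) * pnorm z`. -/
theorem norm_le_of_pnorm_le {z : SpaceTime n} {R : ℝ} (h : pnorm z ≤ R) (hR : 1 ≤ R) :
    ‖z‖ ≤ R * pnorm z := by
  have h0 := pnorm_nonneg z
  rw [Prod.norm_def]
  refine max_le ((norm_fst_le_pnorm z).trans (by nlinarith)) ?_
  exact (abs_snd_le_pnorm_sq z).trans (by nlinarith)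

/-- The volume of the unit ball of `ℝⁿ`. -/
def ballVol (n : ℕ) : ℝ := volume.real (Metric.ball (0 : EuclideanSpace ℝ (Fin n)) 1)

theorem ballVol_pos : 0 < ballVol n :=
  ENNReal.toReal_pos (Metric.measure_ball_pos _ _ one_pos).ne' measure_ball_lt_top.ne

theorem volume_Q {r : ℝ} (hr : 0 < r) :
    volume (Q n r) = ENNReal.ofReal (ballVol n * r ^ (n + 2)) := by
  rw [Q, Measure.volume_eq_prod, Measure.prod_prod, Measure.addHaar_ball_of_pos _ _ hr,
    Real.volume_Ioc, finrank_euclideanSpace_fin,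
    ← ENNReal.ofReal_toReal (measure_ball_lt_top (μ := volume)
      (x := (0 : EuclideanSpace ℝ (Fin n))) (r := 1)).ne,
    ← ENNReal.ofReal_mul (by positivity), ← ENNReal.ofReal_mul (by positivity)]
  congr 1
  rw [ballVol, Measure.real]
  ring

theorem meanOsc_eq (f P : SpaceTime n → ℝ) {r : ℝ} (hr : 0 < r) :
    meanOsc f P r = (∫⁻ z in Q n r, ‖f z - P z‖ₑ) / ENNReal.ofReal (ballVol n * r ^ (n + 2)) := by
  rw [meanOsc, setLAverage_eq, volume_Q hr]

/-- The multi-index factorial `σ!`. -/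
def fct (σ : (Fin n → ℕ) × ℕ) : ℝ := (((∏ i, (σ.1 i)!) * (σ.2)! : ℕ) : ℝ)

theorem one_le_fct (σ : (Fin n → ℕ) × ℕ) : 1 ≤ fct σ := by
  unfold fct
  exact_mod_cast Nat.mul_pos (Finset.prod_pos fun i _ => Nat.factorial_pos _) (Nat.factorial_pos _)

theorem parabolicPoly_eq_sum_fct (k : ℕ) (a : (Fin n → ℕ) × ℕ → ℝ) (z : SpaceTime n) :
    parabolicPoly k a z = ∑ σ ∈ multiIndices n k, a σ / fct σ * mono σ z := rfl

theorem continuous_parabolicPoly (k : ℕ) (a : (Fin n → ℕ) × ℕ → ℝ) :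
    Continuous (parabolicPoly k a : SpaceTime n → ℝ) := by
  simp only [funext (parabolicPoly_eq_sum_fct k a)]
  exact continuous_finsetSum _ fun σ _ => (continuous_mono σ).const_mul _

/-! ### The fractional heat kernel extended by zero -/

/-- The function `u^{-a} e^{-1/(4u)}` of `u > 0`, extended by zero to `u ≤ 0`. -/
def profile (a u : ℝ) : ℝ := if 0 < u then u ^ (-a) * Real.exp (-(1 / (4 * u))) else 0

open Filter Topology in
theorem tendsto_profile_zero (a : ℝ) : Tendsto (profile a) (𝓝 0) (𝓝 0) := by
  have h1 : Tendsto (profile a) (𝓝[>] 0) (𝓝 0) := by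
    have := (tendsto_rpow_mul_exp_neg_mul_atTop_nhds_zero a (1 / 4) (by norm_num)).comp
      tendsto_inv_nhdsGT_zero
    refine this.congr' ?_
    filter_upwards [self_mem_nhdsWithin] with u hu
    have hu' : (0 : ℝ) < u := hu
    simp only [Function.comp, profile, if_pos hu']
    rw [Real.inv_rpow hu'.le, Real.rpow_neg hu'.le]
    congr 2
    field_simp
  have h2 : Tendsto (profile a) (𝓝[≤] 0) (𝓝 0) := by
    refine tendsto_const_nhds.congr' ?_
    filter_upwards [self_mem_nhdsWithin] with u hu
    rw [profile, if_neg (not_lt.2 hu)]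
  have h3 := h2.sup h1
  rwa [nhdsLE_sup_nhdsGT] at h3

open Filter Topology in
theorem hasDerivAt_profile (a u : ℝ) :
    HasDerivAt (profile a) (-a * profile (a + 1) u + 1 / 4 * profile (a + 2) u) u := by
  rcases lt_trichotomy u 0 with hu | rfl | hu
  · have h0 : ∀ b, profile b u = 0 := fun b => if_neg hu.not_gt
    rw [h0, h0, mul_zero, mul_zero, add_zero]
    refine (hasDerivAt_const u (0 : ℝ)).congr_of_eventuallyEq ?_
    filter_upwards [gt_mem_nhds hu] with v hv using if_neg hv.not_gt
  · have h0 : ∀ b, profile b 0 = 0 := fun b => if_neg (lt_irrefl 0)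
    rw [h0, h0, mul_zero, mul_zero, add_zero, hasDerivAt_iff_tendsto_slope_zero]
    refine ((tendsto_profile_zero (a + 1)).mono_left nhdsWithin_le_nhds).congr' ?_
    filter_upwards [self_mem_nhdsWithin] with v hv
    rw [zero_add, h0, sub_zero, smul_eq_mul]
    rcases lt_or_gt_of_ne (show v ≠ 0 from hv) with hv | hv
    · simp [profile, hv.not_gt]
    · simp only [profile, if_pos hv]
      rw [neg_add, Real.rpow_add hv, Real.rpow_neg_one]
      ring
  · have hd : HasDerivAt (fun v : ℝ => v ^ (-a) * Real.exp (-(1 / (4 * v))))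
        (-a * profile (a + 1) u + 1 / 4 * profile (a + 2) u) u := by
      have h1 := Real.hasDerivAt_rpow_const (x := u) (p := -a) (Or.inl hu.ne')
      have h2 : HasDerivAt (fun v : ℝ => -(1 / (4 * v))) (1 / (4 * u ^ 2)) u := by
        have := ((hasDerivAt_inv hu.ne').const_mul (-(1 / 4) : ℝ))
        refine (this.congr_deriv ?_).congr_of_eventuallyEq ?_
        · field_simp
        · filter_upwards with v
          field_simp
      refine (h1.mul h2.exp).congr_deriv ?_
      simp only [profile, if_pos hu]
      rw [show -(a + 2) = -a - 2 by ring, show -(a + 1) = -a - 1 by ring,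
        Real.rpow_sub hu, Real.rpow_sub hu, Real.rpow_one, Real.rpow_two]
      field_simp
    refine hd.congr_of_eventuallyEq ?_
    filter_upwards [lt_mem_nhds hu] with v hv using if_pos hv

/-- The family `profile a` is closed under differentiation, hence consists of smooth functions. -/
theorem contDiff_profile (a : ℝ) {m : ℕ} : ContDiff ℝ m (profile a) := by
  induction m generalizing a with
  | zero =>
    exact contDiff_zero.2 (continuous_iff_continuousAt.2 fun u =>
      (hasDerivAt_profile a u).continuousAt)
  | succ m ih =>
    rw [Nat.cast_succ, contDiff_succ_iff_deriv]
    refine ⟨fun u => (hasDerivAt_profile a u).differentiableAt, fun h => absurd h (by simp), ?_⟩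
    rw [funext fun u => (hasDerivAt_profile a u).deriv]
    exact (contDiff_const.mul (ih _)).add (contDiff_const.mul (ih _))

/-- The normalising constant `C_{n,s}` of the fractional heat kernel. -/
def kconst (n : ℕ) (s : ℝ) : ℝ := 1 / ((4 * Real.pi) ^ ((n : ℝ) / 2) * |Real.Gamma (-s)|)

theorem kconst_nonneg (n : ℕ) (s : ℝ) : 0 ≤ kconst n s := by
  unfold kconst; positivity

/-- The fractional heat kernel on space-time, extended by zero to `t ≤ 0`. -/
def kext (s : ℝ) (z : SpaceTime n) : ℝ := if 0 < z.2 then kernel s z.1 z.2 else 0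

theorem kernel_eq (s : ℝ) (x : EuclideanSpace ℝ (Fin n)) (t : ℝ) :
    kernel s x t = kconst n s *
      (Real.exp (-(‖x‖ ^ 2) / (4 * t)) / t ^ ((n : ℝ) / 2 + 1 - s)) := rfl

theorem kext_nonneg (s : ℝ) (z : SpaceTime n) : 0 ≤ kext s z := by
  unfold kext
  split_ifs with h
  · rw [kernel_eq]
    exact mul_nonneg (kconst_nonneg _ _) (by positivity)
  · exact le_rfl

theorem measurable_kext (s : ℝ) : Measurable (kext s : SpaceTime n → ℝ) := by
  unfold kext
  refine Measurable.ite (measurableSet_lt measurable_const measurable_snd) ?_ measurable_const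
  simp only [kernel_eq]
  fun_prop

theorem kext_eq_profile (s : ℝ) {z : SpaceTime n} (hz : z.1 ≠ 0) :
    kext s z = kconst n s * ((‖z.1‖ ^ 2) ^ (-((n : ℝ) / 2 + 1 - s)) *
      profile ((n : ℝ) / 2 + 1 - s) (z.2 / ‖z.1‖ ^ 2)) := by
  have h0 : 0 < ‖z.1‖ ^ 2 := by positivity
  by_cases ht : 0 < z.2
  · rw [kext, if_pos ht, profile, if_pos (div_pos ht h0), kernel_eq, Real.div_rpow ht.le h0.le,
      Real.rpow_neg ht.le, Real.rpow_neg h0.le]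
    have h1 : 0 < (‖z.1‖ ^ 2) ^ ((n : ℝ) / 2 + 1 - s) := Real.rpow_pos_of_pos h0 _
    have h2 : 0 < z.2 ^ ((n : ℝ) / 2 + 1 - s) := Real.rpow_pos_of_pos ht _
    have h3 : -‖z.1‖ ^ 2 / (4 * z.2) = -(1 / (4 * (z.2 / ‖z.1‖ ^ 2))) := by field_simp
    rw [h3]
    field_simp
  · have : ¬ 0 < z.2 / ‖z.1‖ ^ 2 := fun h => ht (by
      have := mul_pos h h0
      rwa [div_mul_cancel₀ _ h0.ne'] at this)
    rw [kext, if_neg ht, profile, if_neg this, mul_zero, mul_zero]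

theorem contDiffAt_kext (s : ℝ) {z : SpaceTime n} (hz : z ≠ 0) {m : ℕ} :
    ContDiffAt ℝ m (kext s) z := by
  by_cases hx : z.1 = 0
  · have ht : z.2 ≠ 0 := fun h => hz (Prod.ext hx h)
    rcases lt_or_gt_of_ne ht with ht | ht
    · refine (contDiffAt_const (c := (0 : ℝ))).congr_of_eventuallyEq ?_
      filter_upwards [continuous_snd.continuousAt.eventually (gt_mem_nhds ht)] with w hw
      exact if_neg hw.not_gt
    · have : ContDiffAt ℝ m (fun w : SpaceTime n => kernel s w.1 w.2) z := by
        simp only [kernel_eq]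
        refine contDiffAt_const.mul (ContDiffAt.div (ContDiffAt.exp (ContDiffAt.div ?_ ?_ ?_))
          (ContDiffAt.rpow_const_of_ne contDiffAt_snd ht.ne') (Real.rpow_pos_of_pos ht _).ne')
        · exact ((contDiff_norm_sq ℝ).contDiffAt.comp z contDiffAt_fst).neg
        · exact contDiffAt_const.mul contDiffAt_snd
        · positivity
      refine this.congr_of_eventuallyEq ?_
      filter_upwards [continuous_snd.continuousAt.eventually (lt_mem_nhds ht)] with w hw
      exact if_pos hw
  · have h0 : ‖z.1‖ ^ 2 ≠ 0 := by positivity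
    have hn : ContDiffAt ℝ m (fun w : SpaceTime n => ‖w.1‖ ^ 2) z :=
      (contDiff_norm_sq ℝ).contDiffAt.comp z contDiffAt_fst
    have : ContDiffAt ℝ m (fun w : SpaceTime n =>
        kconst n s * ((‖w.1‖ ^ 2) ^ (-((n : ℝ) / 2 + 1 - s)) *
          profile ((n : ℝ) / 2 + 1 - s) (w.2 / ‖w.1‖ ^ 2))) z :=
      contDiffAt_const.mul ((hn.rpow_const_of_ne h0).mul
        ((contDiff_profile _).contDiffAt.comp z (contDiffAt_snd.div hn h0)))
    refine this.congr_of_eventuallyEq ?_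
    filter_upwards [continuous_fst.continuousAt.eventually (isOpen_ne.mem_nhds hx)] with w hw
    exact kext_eq_profile s hw

/-- Minus the parabolic homogeneity of the fractional heat kernel. -/
def gam (n : ℕ) (s : ℝ) : ℝ := n + 2 - 2 * s

theorem kext_dil (s : ℝ) {l : ℝ} (hl : 0 < l) (z : SpaceTime n) :
    kext s (dil l z) = l ^ (-gam n s) * kext s z := by
  have hiff : 0 < (dil l z).2 ↔ 0 < z.2 := by
    simp only [dil]; exact mul_pos_iff_of_pos_left (by positivity)
  by_cases ht : 0 < z.2
  · rw [kext, if_pos (hiff.2 ht), kext, if_pos ht, kernel_eq, kernel_eq]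
    simp only [dil, norm_smul, Real.norm_eq_abs, abs_of_pos hl]
    have h1 : -(l * ‖z.1‖) ^ 2 / (4 * (l ^ 2 * z.2)) = -‖z.1‖ ^ 2 / (4 * z.2) := by
      field_simp
    have h2 : (l ^ 2 : ℝ) ^ ((n : ℝ) / 2 + 1 - s) = l ^ gam n s := by
      rw [← Real.rpow_two, ← Real.rpow_mul hl.le, gam]
      congr 1; ring
    rw [h1, Real.mul_rpow (by positivity) ht.le, h2, Real.rpow_neg hl.le]
    have := Real.rpow_pos_of_pos hl (gam n s)
    field_simp
  · rw [kext, if_neg (hiff.not.2 ht), kext, if_neg ht, mul_zero]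

theorem lintegral_kernel (s : ℝ) {t : ℝ} (ht : 0 < t) :
    ∫⁻ x : EuclideanSpace ℝ (Fin n), ENNReal.ofReal (kernel s x t) =
      ENNReal.ofReal (kconst n s * (4 * Real.pi) ^ ((n : ℝ) / 2) * t ^ (s - 1)) := by
  have hb : 0 < 1 / (4 * t) := by positivity
  have hI : ∫ x : EuclideanSpace ℝ (Fin n), Real.exp (-(1 / (4 * t)) * ‖x‖ ^ 2) =
      (4 * Real.pi) ^ ((n : ℝ) / 2) * t ^ ((n : ℝ) / 2) := by
    rw [GaussianFourier.integral_rexp_neg_mul_sq_norm hb, finrank_euclideanSpace_fin,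
      ← Real.mul_rpow (by positivity) ht.le]
    congr 1
    field_simp
  have hint : Integrable fun x : EuclideanSpace ℝ (Fin n) =>
      Real.exp (-(1 / (4 * t)) * ‖x‖ ^ 2) :=
    Integrable.of_integral_ne_zero (by
      rw [hI]
      have := Real.pi_pos
      positivity)
  have hk : ∀ x : EuclideanSpace ℝ (Fin n), kernel s x t =
      kconst n s * (t ^ ((n : ℝ) / 2 + 1 - s))⁻¹ * Real.exp (-(1 / (4 * t)) * ‖x‖ ^ 2) := by
    intro x
    rw [kernel_eq, show -‖x‖ ^ 2 / (4 * t) = -(1 / (4 * t)) * ‖x‖ ^ 2 by field_simp]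
    ring
  simp only [hk]
  rw [← ofReal_integral_eq_lintegral_ofReal (hint.const_mul _)
    (Filter.Eventually.of_forall fun x => ?_), integral_const_mul, hI]
  · congr 1
    have : t ^ (s - 1) = t ^ ((n : ℝ) / 2) * (t ^ ((n : ℝ) / 2 + 1 - s))⁻¹ := by
      rw [← Real.rpow_neg ht.le, ← Real.rpow_add ht]
      congr 1; ring
    rw [this]; ring
  · have := kconst_nonneg n s
    positivity

/-- The constant in `∫_{t < T} K_{-s} = massConst * T^s`. -/
def massConst (n : ℕ) (s : ℝ) : ℝ := kconst n s * (4 * Real.pi) ^ ((n : ℝ) / 2) / s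

theorem massConst_nonneg {s : ℝ} (hs : 0 < s) : 0 ≤ massConst n s :=
  div_nonneg (mul_nonneg (kconst_nonneg _ _) (by have := Real.pi_pos; positivity)) hs.le

theorem lintegral_kext {s : ℝ} (hs : 0 < s) {T : ℝ} (hT : 0 ≤ T) :
    ∫⁻ z in {z : SpaceTime n | z.2 < T}, ENNReal.ofReal (kext s z) =
      ENNReal.ofReal (massConst n s * T ^ s) := by
  have hm : MeasurableSet {z : SpaceTime n | z.2 < T} :=
    measurableSet_lt measurable_snd measurable_const
  have hmeas : Measurable fun z : SpaceTime n => ENNReal.ofReal (kext s z) :=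
    (measurable_kext s).ennreal_ofReal
  rw [← lintegral_indicator hm, Measure.volume_eq_prod,
    lintegral_prod_symm' _ (hmeas.indicator hm)]
  have h1 : ∀ t : ℝ, ∫⁻ x : EuclideanSpace ℝ (Fin n),
      {z : SpaceTime n | z.2 < T}.indicator (fun z => ENNReal.ofReal (kext s z)) (x, t) =
      (Ioo 0 T).indicator (fun t => ENNReal.ofReal
        (kconst n s * (4 * Real.pi) ^ ((n : ℝ) / 2) * t ^ (s - 1))) t := by
    intro t
    by_cases ht : t ∈ Ioo 0 T
    · rw [indicator_of_mem ht, ← lintegral_kernel s ht.1]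
      refine lintegral_congr fun x => ?_
      rw [indicator_of_mem (show (x, t) ∈ {z : SpaceTime n | z.2 < T} from ht.2), kext,
        if_pos ht.1]
    · rw [indicator_of_notMem ht]
      refine (lintegral_congr fun x => ?_).trans lintegral_zero
      rw [indicator_apply, kext]
      split_ifs with h h'
      · exact absurd ⟨h', h⟩ ht
      · simp
      · rfl
  rw [lintegral_congr h1, lintegral_indicator measurableSet_Ioo]
  have hii : IntervalIntegrable (fun t : ℝ => t ^ (s - 1)) volume 0 T :=
    intervalIntegral.intervalIntegrable_rpow' (by linarith)
  have hint : IntegrableOn (fun t : ℝ => t ^ (s - 1)) (Ioo 0 T) :=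
    ((intervalIntegrable_iff_integrableOn_Ioc_of_le hT).1 hii).mono_set Ioo_subset_Ioc_self
  rw [← ofReal_integral_eq_lintegral_ofReal (hint.const_mul _), integral_const_mul,
    ← integral_Ioc_eq_integral_Ioo, ← intervalIntegral.integral_of_le hT,
    integral_rpow (Or.inl (by linarith)), sub_add_cancel, Real.zero_rpow hs.ne', massConst]
  · congr 1; ring
  · refine (ae_restrict_iff' measurableSet_Ioo).2 (Filter.Eventually.of_forall fun t ht => ?_)
    have := kconst_nonneg n s
    have := Real.pi_pos
    have := ht.1
    show 0 ≤ _
    positivity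

/-! ### Taylor expansion in parabolic monomials -/

/-- The space-time coordinates; `none` is time. -/
def coord : Option (Fin n) → SpaceTime n → ℝ
  | none, z => z.2
  | some i, z => z.1 i

/-- The standard basis of space-time; `none` is the time direction. -/
def stdVec : Option (Fin n) → SpaceTime n
  | none => (0, 1)
  | some i => (EuclideanSpace.single i 1, 0)

/-- The exponent of the monomial `coord i z * z^σ`. -/
def incIndex : Option (Fin n) → (Fin n → ℕ) × ℕ → (Fin n → ℕ) × ℕ
  | none, σ => (σ.1, σ.2 + 1)
  | some i, σ => (σ.1 + Pi.single i 1, σ.2)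

/-- The isotropic degree of a multi-index, in which time counts once. -/
def isoDeg (σ : (Fin n → ℕ) × ℕ) : ℕ := ∑ i, σ.1 i + σ.2

theorem mono_incIndex (i : Option (Fin n)) (σ : (Fin n → ℕ) × ℕ) (z : SpaceTime n) :
    mono (incIndex i σ) z = coord i z * mono σ z := by
  cases i with
  | none => simp only [mono, incIndex, coord, pow_succ]; ring
  | some i =>
    simp only [mono, incIndex, coord, Pi.add_apply, pow_add, Finset.prod_mul_distrib]
    have : ∏ j, z.1 j ^ (Pi.single i 1 : Fin n → ℕ) j = z.1 i := by
      rw [Finset.prod_eq_single i]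
      · simp
      · intro j _ hj; simp [Pi.single_eq_of_ne hj]
      · simp
    rw [this]; ring

theorem mono_smul (l : ℝ) (σ : (Fin n → ℕ) × ℕ) (z : SpaceTime n) :
    mono σ (l • z) = l ^ isoDeg σ * mono σ z := by
  simp only [mono, isoDeg, Prod.smul_fst, Prod.smul_snd, PiLp.smul_apply, smul_eq_mul, mul_pow,
    Finset.prod_mul_distrib, Finset.prod_pow_eq_pow_sum, pow_add]
  ring

theorem sum_coord_smul_stdVec (z : SpaceTime n) : ∑ i, coord i z • stdVec i = z := by
  rw [Fintype.sum_option]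
  ext j
  · simp [coord, stdVec, Prod.fst_sum, Finset.sum_apply, Pi.single_apply]
  · simp [coord, stdVec, Prod.snd_sum]

theorem abs_coord_le (i : Option (Fin n)) (z : SpaceTime n) : |coord i z| ≤ ‖z‖ := by
  cases i with
  | none => exact norm_snd_le z
  | some i => exact (PiLp.norm_apply_le z.1 i).trans (norm_fst_le z)

theorem pnorm_smul_le {l : ℝ} (h0 : 0 ≤ l) (h1 : l ≤ 1) (z : SpaceTime n) :
    pnorm (l • z) ≤ pnorm z := by
  simp only [pnorm, Prod.smul_fst, Prod.smul_snd, norm_smul, smul_eq_mul, abs_mul,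
    Real.norm_eq_abs, abs_of_nonneg h0]
  exact max_le_max (mul_le_of_le_one_left (norm_nonneg _) h1)
    (Real.sqrt_le_sqrt (mul_le_of_le_one_left (abs_nonneg _) h1))

theorem exists_bound_of_pnorm_le {G : SpaceTime n → ℝ} (hG : Continuous G) (R : ℝ) :
    ∃ C, 0 ≤ C ∧ ∀ z, pnorm z ≤ R → |G z| ≤ C := by
  obtain ⟨C, hC⟩ := (isCompact_closedBall (0 : SpaceTime n)
    (max R 1 * max R 1)).exists_bound_of_continuousOn hG.continuousOn
  refine ⟨max C 0, le_max_right _ _, fun z hz => (hC z ?_).trans (le_max_left _ _)⟩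
  rw [mem_closedBall_zero_iff]
  have hz' : pnorm z ≤ max R 1 := hz.trans (le_max_left _ _)
  exact (norm_le_of_pnorm_le hz' (le_max_right _ _)).trans
    (mul_le_mul_of_nonneg_left hz' (zero_le_one.trans (le_max_right _ _)))

/-- Taylor's formula with coefficients continuous in the base point, the polynomial being any finite
combination of monomials. By induction on the order: the expansions of the partial derivatives are
integrated along segments. -/
theorem exists_taylor_aux (M : ℕ) : ∀ G : SpaceTime n → ℝ, (∀ m : ℕ, ContDiff ℝ m G) →
    ∃ (J : Type) (_ : Fintype J) (μ : J → (Fin n → ℕ) × ℕ) (c : J → SpaceTime n → ℝ),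
      (∀ j, Continuous (c j)) ∧ ∀ R, ∃ C, 0 ≤ C ∧ ∀ p z, pnorm p ≤ R → pnorm z ≤ R →
        |G (p + z) - ∑ j, c j p * mono (μ j) z| ≤ C * pnorm z ^ M := by
  induction M with
  | zero =>
    intro G hG
    refine ⟨Empty, inferInstance, fun j => j.elim, fun j => j.elim, fun j => j.elim, fun R => ?_⟩
    obtain ⟨C, hC0, hC⟩ := exists_bound_of_pnorm_le (hG 0).continuous (R + R)
    refine ⟨C, hC0, fun p z hp hz => ?_⟩
    simpa using hC (p + z) ((pnorm_add_le p z).trans (add_le_add hp hz))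
  | succ M ih =>
    intro G hG
    have hD : ∀ (i : Option (Fin n)) (m : ℕ), ContDiff ℝ m fun w => fderiv ℝ G w (stdVec i) :=
      fun i m => ((hG (m + 1)).fderiv_right (m := m) (by norm_cast)).clm_apply contDiff_const
    choose J hJ μ c hc hT using fun i => ih _ (hD i)
    refine ⟨Option (Σ i, J i), inferInstance,
      fun j => j.elim 0 fun j => incIndex j.1 (μ j.1 j.2),
      fun j p => j.elim (G p) fun j => c j.1 j.2 p / (isoDeg (μ j.1 j.2) + 1), ?_, fun R => ?_⟩
    · rintro (_ | ⟨i, j⟩)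
      · exact (hG 0).continuous
      · exact (hc i j).div_const _
    choose C hC0 hC using fun i => hT i R
    refine ⟨∑ i, max R 1 * C i, Finset.sum_nonneg fun i _ =>
      mul_nonneg (zero_le_one.trans (le_max_right _ _)) (hC0 i), fun p z hp hz => ?_⟩
    -- the remainder along the segment from `p` to `p + z`
    set F : ℝ → ℝ := fun l => G (p + l • z) - ∑ i, ∑ j, c i j p / (isoDeg (μ i j) + 1) *
      (coord i z * (l ^ (isoDeg (μ i j) + 1) * mono (μ i j) z)) with hF
    set F' : ℝ → ℝ := fun l => ∑ i, coord i z *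
      (fderiv ℝ G (p + l • z) (stdVec i) - ∑ j, c i j p * mono (μ i j) (l • z)) with hF'
    have hder : ∀ l, HasDerivAt F (F' l) l := by
      intro l
      have h1 : HasDerivAt (fun l : ℝ => G (p + l • z)) (fderiv ℝ G (p + l • z) z) l := by
        have hg := ((hG 1).differentiable one_ne_zero (p + l • z)).hasFDerivAt
        have hl : HasDerivAt (fun l : ℝ => p + l • z) z l := by
          simpa using ((hasDerivAt_id l).smul_const z).const_add p
        exact hg.comp_hasDerivAt l hl
      have h2 : HasDerivAt (fun l : ℝ => ∑ i, ∑ j, c i j p / (isoDeg (μ i j) + 1) *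
          (coord i z * (l ^ (isoDeg (μ i j) + 1) * mono (μ i j) z)))
          (∑ i, ∑ j, coord i z * (c i j p * mono (μ i j) (l • z))) l := by
        refine HasDerivAt.fun_sum fun i _ => HasDerivAt.fun_sum fun j _ => ?_
        refine ((((hasDerivAt_pow (isoDeg (μ i j) + 1) l).mul_const
          (mono (μ i j) z)).const_mul (coord i z)).const_mul _).congr_deriv ?_
        rw [mono_smul]
        have : ((isoDeg (μ i j) : ℝ) + 1) ≠ 0 := by positivity
        push_cast
        field_simp
      refine (h1.sub h2).congr_deriv ?_
      rw [hF']
      simp only [mul_sub, Finset.sum_sub_distrib, Finset.mul_sum]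
      congr 1
      have h3 := congrArg (fderiv ℝ G (p + l • z)) (sum_coord_smul_stdVec z).symm
      simpa only [map_sum, map_smul, smul_eq_mul] using h3
    have hb : ∀ l ∈ Ico (0 : ℝ) 1, ‖F' l‖ ≤ ∑ i, max R 1 * C i * pnorm z ^ (M + 1) := by
      intro l hl
      refine (norm_sum_le _ _).trans (Finset.sum_le_sum fun i _ => ?_)
      have hlz := pnorm_smul_le hl.1 hl.2.le z
      rw [norm_mul, Real.norm_eq_abs, Real.norm_eq_abs]
      have h1 : |coord i z| ≤ max R 1 * pnorm z := (abs_coord_le i z).trans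
        (norm_le_of_pnorm_le (hz.trans (le_max_left _ _)) (le_max_right _ _))
      have h2 := (hC i p (l • z) hp (hlz.trans hz)).trans
        (mul_le_mul_of_nonneg_left (pow_le_pow_left₀ (pnorm_nonneg _) hlz M) (hC0 i))
      calc _ ≤ (max R 1 * pnorm z) * (C i * pnorm z ^ M) :=
            mul_le_mul h1 h2 (abs_nonneg _) ((abs_nonneg _).trans h1)
        _ = _ := by ring
    have := norm_image_sub_le_of_norm_deriv_le_segment_01'
      (fun l _ => (hder l).hasDerivWithinAt) hb
    rw [← Finset.sum_mul, Real.norm_eq_abs] at this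
    convert this using 2
    rw [Fintype.sum_option, Fintype.sum_sigma]
    simp only [hF, Option.elim, mono_incIndex, one_smul, zero_smul, add_zero, one_pow, one_mul,
      zero_pow (Nat.succ_ne_zero _), zero_mul, mul_zero, Finset.sum_const_zero, sub_zero]
    rw [show mono (0 : (Fin n → ℕ) × ℕ) z = 1 by simp [mono]]
    ring

/-- Taylor's formula in parabolic degree: monomials of parabolic degree above `N` are absorbed by
the remainder. -/
theorem exists_taylor (N : ℕ) {G : SpaceTime n → ℝ} (hG : ∀ m : ℕ, ContDiff ℝ m G) :
    ∃ c : (Fin n → ℕ) × ℕ → SpaceTime n → ℝ,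
      (∀ σ, Continuous (c σ)) ∧ ∀ R, ∃ C, 0 ≤ C ∧ ∀ p z, pnorm p ≤ R → pnorm z ≤ R →
        |G (p + z) - ∑ σ ∈ multiIndices n N, c σ p * mono σ z| ≤ C * pnorm z ^ (N + 1) := by
  classical
  obtain ⟨J, _, μ, c, hc, hT⟩ := exists_taylor_aux (N + 1) G hG
  refine ⟨fun σ p => ∑ j with μ j = σ, c j p, fun σ => continuous_finsetSum _ fun j _ => hc j,
    fun R => ?_⟩
  obtain ⟨C, hC0, hC⟩ := hT R
  choose B hB0 hB using fun j => exists_bound_of_pnorm_le (hc j) R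
  set R' := max R 1
  have hR' : 0 ≤ R' := zero_le_one.trans (le_max_right _ _)
  refine ⟨C + ∑ j, B j * R' ^ deg (μ j), add_nonneg hC0 (Finset.sum_nonneg fun j _ =>
    mul_nonneg (hB0 j) (pow_nonneg hR' _)), fun p z hp hz => ?_⟩
  have hsplit : ∑ j, c j p * mono (μ j) z =
      ∑ σ ∈ multiIndices n N, (∑ j with μ j = σ, c j p) * mono σ z +
        ∑ j with ¬ μ j ∈ multiIndices n N, c j p * mono (μ j) z := by
    rw [← Finset.sum_filter_add_sum_filter_not Finset.univ (fun j => μ j ∈ multiIndices n N)]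
    congr 1
    rw [← Finset.sum_fiberwise_of_maps_to (s := Finset.univ.filter fun j => μ j ∈ multiIndices n N)
      (t := multiIndices n N) (g := μ) (fun j hj => (Finset.mem_filter.1 hj).2)]
    refine Finset.sum_congr rfl fun σ hσ => ?_
    rw [Finset.sum_mul, Finset.filter_filter]
    refine Finset.sum_congr ?_ fun j hj => by rw [(Finset.mem_filter.1 hj).2]
    ext j
    simp only [Finset.mem_filter, Finset.mem_univ, true_and]
    exact ⟨fun h => h.2, fun h => ⟨h ▸ hσ, h⟩⟩
  have hrest : |∑ j with ¬ μ j ∈ multiIndices n N, c j p * mono (μ j) z| ≤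
      ∑ j, B j * R' ^ deg (μ j) * pnorm z ^ (N + 1) := by
    refine (Finset.abs_sum_le_sum_abs _ _).trans ((Finset.sum_le_sum fun j hj => ?_).trans
      (Finset.sum_le_univ_sum_of_nonneg fun j => mul_nonneg (mul_nonneg (hB0 j)
        (pow_nonneg hR' _)) (pow_nonneg (pnorm_nonneg z) _)))
    have hdeg : N + 1 ≤ deg (μ j) := by
      have := (Finset.mem_filter.1 hj).2
      rw [mem_multiIndices_iff_deg] at this
      omega
    have h1 : pnorm z ^ deg (μ j) ≤ R' ^ deg (μ j) * pnorm z ^ (N + 1) := by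
      obtain ⟨d, hd⟩ := Nat.exists_eq_add_of_le hdeg
      have h2 : pnorm z ^ d ≤ R' ^ d :=
        pow_le_pow_left₀ (pnorm_nonneg z) (hz.trans (le_max_left _ _)) _
      have h3 : R' ^ d ≤ R' ^ deg (μ j) := pow_le_pow_right₀ (le_max_right _ _) (by omega)
      calc pnorm z ^ deg (μ j) = pnorm z ^ d * pnorm z ^ (N + 1) := by rw [hd]; ring
        _ ≤ _ := mul_le_mul_of_nonneg_right (h2.trans h3) (pow_nonneg (pnorm_nonneg z) _)
    rw [abs_mul, mul_assoc]
    exact mul_le_mul (hB j p hp) ((abs_mono_le _ _).trans h1) (abs_nonneg _) (hB0 j)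
  have h := hC p z hp hz
  rw [hsplit] at h
  rw [add_mul, Finset.sum_mul]
  calc _ = |(G (p + z) - (∑ σ ∈ multiIndices n N, (∑ j with μ j = σ, c j p) * mono σ z +
        ∑ j with ¬ μ j ∈ multiIndices n N, c j p * mono (μ j) z)) +
        ∑ j with ¬ μ j ∈ multiIndices n N, c j p * mono (μ j) z| := by
          congr 1; ring
    _ ≤ _ := (abs_add_le _ _).trans (add_le_add h hrest)

/-! ### Expansion of the kernel at points away from its pole -/

/-- A smooth cutoff near the origin, equal to `1` on the ball of radius `1/8` and supported in the
ball of radius `1/4` (in the sup norm of the product). -/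
def poleBump (n : ℕ) : ContDiffBump (0 : SpaceTime n) := ⟨1 / 8, 1 / 4, by norm_num, by norm_num⟩

/-- The kernel with its pole removed; a smooth function on all of space-time. -/
def regKernel (s : ℝ) (z : SpaceTime n) : ℝ := (1 - poleBump n z) * kext s z

theorem contDiff_regKernel (s : ℝ) (m : ℕ) : ContDiff ℝ m (regKernel s : SpaceTime n → ℝ) := by
  rw [contDiff_iff_contDiffAt]
  intro z
  by_cases hz : z = 0
  · subst hz
    refine (contDiffAt_const (c := (0 : ℝ))).congr_of_eventuallyEq ?_
    filter_upwards [(poleBump n).eventuallyEq_one] with w hw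
    simp [regKernel, hw]
  · exact (contDiffAt_const.sub (poleBump n).contDiff.contDiffAt).mul (contDiffAt_kext s hz)

theorem regKernel_eq (s : ℝ) {z : SpaceTime n} (hz : 1 / 4 ≤ ‖z‖) : regKernel s z = kext s z := by
  rw [regKernel, (poleBump n).zero_of_le_dist (by rwa [dist_zero_right]), sub_zero, one_mul]

theorem quarter_le_norm {z : SpaceTime n} (hz : 1 / 2 ≤ pnorm z) : 1 / 4 ≤ ‖z‖ := by
  rw [Prod.norm_def]
  rcases le_max_iff.1 hz with h | h
  · exact le_max_of_le_left (by linarith)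
  · refine le_max_of_le_right ?_
    rw [Real.le_sqrt' (by norm_num)] at h
    rw [Real.norm_eq_abs]
    linarith

/-- The parabolic Taylor expansion of `z ↦ K_{-s}(z - p)` at the origin. It is found on the
parabolic unit sphere `pnorm p = 1`, by compactness, and transported by scaling. -/
theorem exists_kernel_expansion (n : ℕ) (s : ℝ) (N : ℕ) :
    ∃ (c : (Fin n → ℕ) × ℕ → SpaceTime n → ℝ) (C : ℝ), 0 ≤ C ∧ (∀ σ, Measurable (c σ)) ∧
      (∀ σ ∈ multiIndices n N, ∀ p, 0 < pnorm p →
        |c σ p| ≤ C * (pnorm p ^ (-gam n s) * (pnorm p)⁻¹ ^ deg σ)) ∧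
      ∀ p z, 0 < pnorm p → pnorm z ≤ pnorm p / 2 →
        |kext s (z - p) - ∑ σ ∈ multiIndices n N, c σ p * mono σ z| ≤
          C * (pnorm p ^ (-gam n s) * (pnorm z / pnorm p) ^ (N + 1)) := by
  obtain ⟨c, hc, hT⟩ := exists_taylor N (contDiff_regKernel (n := n) s)
  obtain ⟨C, hC0, hC⟩ := hT 1
  choose B hB0 hB using fun σ => exists_bound_of_pnorm_le (hc σ) 1
  set hat : SpaceTime n → SpaceTime n := fun p => dil (pnorm p)⁻¹ p with hhat
  have hpn : ∀ p : SpaceTime n, 0 < pnorm p → pnorm (hat p) = 1 := fun p hp => by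
    rw [hhat, pnorm_dil (inv_nonneg.2 hp.le), inv_mul_cancel₀ hp.ne']
  have hmeas : Measurable hat := by
    have := (continuous_pnorm (n := n)).measurable
    simp only [hhat, dil]
    fun_prop
  refine ⟨fun σ p => pnorm p ^ (-gam n s) * (pnorm p)⁻¹ ^ deg σ * c σ (-hat p),
    C + ∑ σ ∈ multiIndices n N, B σ, add_nonneg hC0 (Finset.sum_nonneg fun σ _ => hB0 σ),
    fun σ => ?_, fun σ hσ p hp => ?_, fun p z hp hz => ?_⟩
  · have := (continuous_pnorm (n := n)).measurable
    have := (hc σ).measurable.comp hmeas.neg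
    simp only [Function.comp_def, Pi.neg_apply] at this
    fun_prop
  · have h0 : 0 ≤ pnorm p ^ (-gam n s) * (pnorm p)⁻¹ ^ deg σ := by positivity
    rw [abs_mul, abs_of_nonneg h0, mul_comm]
    refine mul_le_mul_of_nonneg_right ((hB σ _ ?_).trans ?_) h0
    · rw [pnorm_neg, hpn p hp]
    · exact (Finset.single_le_sum (fun σ _ => hB0 σ) hσ).trans (le_add_of_nonneg_left hC0)
  · set l := pnorm p with hl
    have hlz : dil l (dil l⁻¹ z) = z := by rw [dil_dil, mul_inv_cancel₀ hp.ne', dil_one]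
    have hlp : dil l (hat p) = p := by
      rw [hhat]; simp only [← hl]; rw [dil_dil, mul_inv_cancel₀ hp.ne', dil_one]
    -- the rescaled point, at which the expansion with pole on the unit sphere applies
    set y := dil l⁻¹ z with hy
    have hyn : pnorm y = pnorm z / l := by
      rw [hy, pnorm_dil (inv_nonneg.2 hp.le), inv_mul_eq_div]
    have hy2 : pnorm y ≤ 1 / 2 := by rw [hyn, div_le_iff₀ hp]; linarith
    have hk : kext s (z - p) = l ^ (-gam n s) * regKernel s (-hat p + y) := by
      have h0 : z - p = dil l (-hat p + y) := by rw [neg_add_eq_sub, dil_sub, hlp, hlz]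
      rw [h0, kext_dil s hp, regKernel_eq]
      apply quarter_le_norm
      have h1 := pnorm_add_le (-hat p + y) (-y)
      rw [add_neg_cancel_right, pnorm_neg, pnorm_neg, hpn p hp] at h1
      linarith
    have hsum : ∑ σ ∈ multiIndices n N, l ^ (-gam n s) * l⁻¹ ^ deg σ * c σ (-hat p) * mono σ z =
        l ^ (-gam n s) * ∑ σ ∈ multiIndices n N, c σ (-hat p) * mono σ y := by
      rw [Finset.mul_sum]
      refine Finset.sum_congr rfl fun σ _ => ?_
      rw [hy, mono_dil]; ring
    rw [hk, hsum, ← mul_sub, abs_mul, abs_of_nonneg (by positivity), ← hyn, mul_left_comm]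
    refine mul_le_mul_of_nonneg_left ?_ (by positivity)
    refine (hC (-hat p) y (by rw [pnorm_neg, hpn p hp]) (by linarith)).trans ?_
    exact mul_le_mul_of_nonneg_right
      (le_add_of_nonneg_right (Finset.sum_nonneg fun σ _ => hB0 σ))
      (pow_nonneg (pnorm_nonneg y) _)

/-- The weight `u^N min(1, u)`: a remainder of order `N + 1` for `u ≤ 1`, the size of the top order
Taylor terms for `u ≥ 1`. -/
def wt (N : ℕ) (u : ℝ) : ℝ := u ^ N * min 1 u

theorem wt_nonneg (N : ℕ) {u : ℝ} (hu : 0 ≤ u) : 0 ≤ wt N u := by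
  have : 0 ≤ min 1 u := le_min zero_le_one hu
  unfold wt; positivity

theorem wt_mono (N : ℕ) {u v : ℝ} (hu : 0 ≤ u) (huv : u ≤ v) : wt N u ≤ wt N v :=
  mul_le_mul (pow_le_pow_left₀ hu huv N) (min_le_min_left 1 huv) (le_min zero_le_one hu)
    (pow_nonneg (hu.trans huv) N)

/-- The powers up to the `N`-th are controlled by the weight, away from `u = 0`. -/
theorem pow_le_wt {N d : ℕ} (hd : d ≤ N) {u : ℝ} (hu : 1 / 2 ≤ u) :
    u ^ d ≤ 2 ^ (N + 1) * wt N u := by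
  have h1 : 1 ≤ 2 * min 1 u := by
    rcases le_total 1 u with h | h
    · rw [min_eq_left h]; norm_num
    · rw [min_eq_right h]; linarith
  obtain ⟨e, rfl⟩ := Nat.exists_eq_add_of_le hd
  have h2 : 1 ≤ (2 * u) ^ e := one_le_pow₀ (by linarith)
  have h3 : (1 : ℝ) ≤ 2 ^ d := one_le_pow₀ (by norm_num)
  have h0 : 0 ≤ u ^ d := by positivity
  calc u ^ d = u ^ d * 1 * 1 * 1 := by ring
    _ ≤ u ^ d * 2 ^ d * (2 * u) ^ e * (2 * min 1 u) := by gcongr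
    _ = 2 ^ (d + e + 1) * wt (d + e) u := by rw [wt]; ring

/-- The mass of the kernel over a cylinder centred at the origin. -/
theorem lintegral_kext_sub_le {s : ℝ} (hs : 0 < s) {p : SpaceTime n} {r T : ℝ}
    (hT : -p.2 < T) (hT0 : 0 ≤ T) :
    ∫⁻ z in Q n r, ENNReal.ofReal (kext s (z - p)) ≤ ENNReal.ofReal (massConst n s * T ^ s) := by
  classical
  have hm : MeasurableSet {z : SpaceTime n | z.2 < T} :=
    measurableSet_lt measurable_snd measurable_const
  rw [← lintegral_kext hs hT0, ← lintegral_indicator (measurableSet_Q r), ← lintegral_indicator hm]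
  refine (lintegral_mono fun z => ?_).trans_eq (lintegral_sub_right_eq_self _ p)
  rw [indicator_apply, indicator_apply]
  split_ifs with h h'
  · exact le_rfl
  · refine absurd ?_ h'
    have := h.2.2
    simp only [mem_ofPred_eq, Prod.snd_sub]
    linarith
  · exact bot_le
  · exact le_rfl

/-- Integrated over `Q_ρ`, the remainder of the expansion is controlled at every point `p`, near or
far: for `ρ ≤ pnorm p / 2` by Taylor's formula, otherwise term by term. -/
theorem lintegral_remainder_le {s : ℝ} (hs : 0 < s) (hs₁ : s < 1) {N : ℕ}
    {c : (Fin n → ℕ) × ℕ → SpaceTime n → ℝ} {C : ℝ} (hC : 0 ≤ C)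
    (hc : ∀ σ ∈ multiIndices n N, ∀ p, 0 < pnorm p →
        |c σ p| ≤ C * (pnorm p ^ (-gam n s) * (pnorm p)⁻¹ ^ deg σ))
    (hT : ∀ p z, 0 < pnorm p → pnorm z ≤ pnorm p / 2 →
        |kext s (z - p) - ∑ σ ∈ multiIndices n N, c σ p * mono σ z| ≤
          C * (pnorm p ^ (-gam n s) * (pnorm z / pnorm p) ^ (N + 1))) :
    ∃ D : ℝ, 0 ≤ D ∧ ∀ (p : SpaceTime n) (r : ℝ), 0 < pnorm p → 0 < r →
      ∫⁻ z in Q n r, ‖kext s (z - p) - ∑ σ ∈ multiIndices n N, c σ p * mono σ z‖ₑ ≤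
        ENNReal.ofReal (D * (ballVol n * r ^ (n + 2)) *
          (pnorm p ^ (-gam n s) * wt N (r / pnorm p))) := by
  have hv := ballVol_pos (n := n)
  have hgam : 0 < gam n s := by unfold gam; have := n.cast_nonneg (α := ℝ); linarith
  set A := massConst n s * 5 ^ s * (2 ^ gam n s * 2 ^ (N + 1)) with hA
  have hA0 : 0 ≤ A := by have := massConst_nonneg (n := n) hs; positivity
  set B : ℝ := ∑ _σ ∈ multiIndices n N, C * 2 ^ (N + 1) with hB
  have hB0 : 0 ≤ B := Finset.sum_nonneg fun _ _ => by positivity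
  refine ⟨C + (A / ballVol n + B), by positivity, fun p r hp hr => ?_⟩
  have hg0 : 0 < pnorm p ^ (-gam n s) := Real.rpow_pos_of_pos hp _
  have hu : 0 < r / pnorm p := by positivity
  have hw0 : 0 ≤ wt N (r / pnorm p) := wt_nonneg N hu.le
  rcases le_or_gt r (pnorm p / 2) with hr2 | hr2
  · have hu1 : r / pnorm p ≤ 1 := by rw [div_le_one hp]; linarith
    calc _ ≤ ∫⁻ _z in Q n r, ENNReal.ofReal (C * (pnorm p ^ (-gam n s) * wt N (r / pnorm p))) := by
          refine setLIntegral_mono' (measurableSet_Q r) fun z hz => ?_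
          rw [Real.enorm_eq_ofReal_abs]
          have hzr := ((mem_Q_iff hr).1 hz).1
          refine ENNReal.ofReal_le_ofReal ((hT p z hp (by linarith)).trans ?_)
          rw [wt, min_eq_right hu1, ← pow_succ]
          have := pnorm_nonneg z
          gcongr
      _ = ENNReal.ofReal (C * (pnorm p ^ (-gam n s) * wt N (r / pnorm p)) *
          (ballVol n * r ^ (n + 2))) := by
          rw [setLIntegral_const, volume_Q hr, ← ENNReal.ofReal_mul (by positivity)]
      _ ≤ _ := by
          refine ENNReal.ofReal_le_ofReal ?_
          have : 0 ≤ (A / ballVol n + B) * (ballVol n * r ^ (n + 2)) *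
            (pnorm p ^ (-gam n s) * wt N (r / pnorm p)) := by positivity
          linarith
  -- here kernel and Taylor polynomial are estimated separately; `u = r / pnorm p ≥ 1/2` makes all
  -- powers `u^d`, `d ≤ N`, and `u^{-γ}` at most a multiple of the weight
  · have hu2 : 1 / 2 ≤ r / pnorm p := by rw [le_div_iff₀ hp]; linarith
    have h1 : ∫⁻ z in Q n r, ENNReal.ofReal (kext s (z - p)) ≤
        ENNReal.ofReal (A * r ^ (n + 2) * (pnorm p ^ (-gam n s) * wt N (r / pnorm p))) := by
      have hT5 : -p.2 < 5 * r ^ 2 := by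
        have := abs_snd_le_pnorm_sq p
        have := neg_le_abs p.2
        nlinarith
      refine (lintegral_kext_sub_le hs hT5 (by positivity)).trans (ENNReal.ofReal_le_ofReal ?_)
      have h2 : (5 * r ^ 2) ^ s = 5 ^ s * (r ^ (n + 2) * r ^ (-gam n s)) := by
        rw [Real.mul_rpow (by norm_num) (by positivity), ← Real.rpow_two, ← Real.rpow_mul hr.le,
          ← Real.rpow_natCast, ← Real.rpow_add hr, gam]
        congr 2
        push_cast; ring
      have h3 : r ^ (-gam n s) ≤
          pnorm p ^ (-gam n s) * (2 ^ gam n s * (2 ^ (N + 1) * wt N (r / pnorm p))) := by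
        have h4 : r ^ (-gam n s) = pnorm p ^ (-gam n s) * (r / pnorm p) ^ (-gam n s) := by
          rw [← Real.mul_rpow hp.le hu.le, mul_div_cancel₀ _ hp.ne']
        have h5 : (r / pnorm p) ^ (-gam n s) ≤ 2 ^ gam n s := by
          rw [Real.rpow_neg hu.le, ← Real.inv_rpow hu.le]
          refine Real.rpow_le_rpow (by positivity) ?_ hgam.le
          rw [inv_le_comm₀ hu (by norm_num)]
          linarith
        have h6 := pow_le_wt (Nat.zero_le N) hu2
        rw [pow_zero] at h6
        rw [h4]
        have : (0 : ℝ) < 2 ^ gam n s := by positivity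
        exact mul_le_mul_of_nonneg_left (h5.trans (le_mul_of_one_le_right this.le h6)) hg0.le
      rw [h2, hA]
      have := massConst_nonneg (n := n) hs
      calc massConst n s * (5 ^ s * (r ^ (n + 2) * r ^ (-gam n s)))
          ≤ massConst n s * (5 ^ s * (r ^ (n + 2) *
            (pnorm p ^ (-gam n s) * (2 ^ gam n s * (2 ^ (N + 1) * wt N (r / pnorm p)))))) := by
            gcongr
        _ = _ := by ring
    have h2 : ∀ z ∈ Q n r, |∑ σ ∈ multiIndices n N, c σ p * mono σ z| ≤
        B * (pnorm p ^ (-gam n s) * wt N (r / pnorm p)) := by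
      intro z hz
      rw [hB, Finset.sum_mul]
      refine (Finset.abs_sum_le_sum_abs _ _).trans (Finset.sum_le_sum fun σ hσ => ?_)
      have hzr := ((mem_Q_iff hr).1 hz).1
      have := pow_le_wt (mem_multiIndices_iff_deg.1 hσ) hu2
      rw [abs_mul]
      calc |c σ p| * |mono σ z|
          ≤ (C * (pnorm p ^ (-gam n s) * (pnorm p)⁻¹ ^ deg σ)) * r ^ deg σ := by
            refine mul_le_mul (hc σ hσ p hp) ((abs_mono_le σ z).trans
              (pow_le_pow_left₀ (pnorm_nonneg z) hzr.le _)) (abs_nonneg _) (by positivity)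
        _ = C * pnorm p ^ (-gam n s) * (r / pnorm p) ^ deg σ := by
            rw [div_eq_inv_mul, mul_pow]; ring
        _ ≤ C * pnorm p ^ (-gam n s) * (2 ^ (N + 1) * wt N (r / pnorm p)) := by gcongr
        _ = _ := by ring
    calc _ ≤ ∫⁻ z in Q n r, (ENNReal.ofReal (kext s (z - p)) +
            ENNReal.ofReal (B * (pnorm p ^ (-gam n s) * wt N (r / pnorm p)))) := by
          refine setLIntegral_mono' (measurableSet_Q r) fun z hz => ?_
          refine enorm_sub_le.trans (add_le_add ?_ ?_)
          · rw [Real.enorm_eq_ofReal (kext_nonneg _ _)]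
          · rw [Real.enorm_eq_ofReal_abs]
            exact ENNReal.ofReal_le_ofReal (h2 z hz)
      _ ≤ ENNReal.ofReal (A * r ^ (n + 2) * (pnorm p ^ (-gam n s) * wt N (r / pnorm p))) +
          ENNReal.ofReal (B * (pnorm p ^ (-gam n s) * wt N (r / pnorm p)) *
            (ballVol n * r ^ (n + 2))) := by
          rw [lintegral_add_right _ measurable_const, setLIntegral_const, volume_Q hr,
            ← ENNReal.ofReal_mul (by positivity)]
          exact add_le_add h1 le_rfl
      _ ≤ _ := by
          rw [← ENNReal.ofReal_add (by positivity) (by positivity)]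
          refine ENNReal.ofReal_le_ofReal ?_
          have h3 : 0 ≤ C * (ballVol n * r ^ (n + 2)) *
            (pnorm p ^ (-gam n s) * wt N (r / pnorm p)) := by positivity
          have h4 : A / ballVol n * (ballVol n * r ^ (n + 2)) = A * r ^ (n + 2) := by
            field_simp
          linear_combination h3 - (pnorm p ^ (-gam n s) * wt N (r / pnorm p)) * h4

/-! ### Potentials of densities supported in the unit cylinder -/

/-- The potential `∫ F(p) K_{-s}(z - p) dp`. -/
def pot (s : ℝ) (F : SpaceTime n → ℝ) (z : SpaceTime n) : ℝ := ∫ p, F p * kext s (z - p)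

/-- The kernel truncated to times `t < 2`, which is integrable. -/
def kcut (s : ℝ) : SpaceTime n → ℝ := {z : SpaceTime n | z.2 < 2}.indicator (kext s)

theorem integrable_kcut {s : ℝ} (hs : 0 < s) : Integrable (kcut s : SpaceTime n → ℝ) := by
  have hm : MeasurableSet {z : SpaceTime n | z.2 < 2} :=
    measurableSet_lt measurable_snd measurable_const
  rw [kcut, integrable_indicator_iff hm]
  refine ⟨(measurable_kext s).aestronglyMeasurable, ?_⟩
  rw [hasFiniteIntegral_iff_ofReal (Filter.Eventually.of_forall fun z => kext_nonneg s z),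
    lintegral_kext hs zero_le_two]
  exact ENNReal.ofReal_lt_top

theorem kcut_nonneg (s : ℝ) (z : SpaceTime n) : 0 ≤ kcut s z :=
  indicator_nonneg (fun z _ => kext_nonneg s z) z

theorem Qtilde_one : Qtilde n 1 = Metric.ball 0 1 := by
  ext z
  rw [mem_Qtilde_iff one_pos, pnorm_lt_iff one_pos, mem_ball_zero_iff, Prod.norm_def, max_lt_iff,
    one_pow, Real.norm_eq_abs]

theorem Q_one_subset : Q n 1 ⊆ Qtilde n 1 := fun _ hz =>
  (mem_Qtilde_iff one_pos).2 ((mem_Q_iff one_pos).1 hz).1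

theorem mul_kext_eq_mul_kcut (s : ℝ) {F : SpaceTime n → ℝ} (hF : ∀ p ∉ Qtilde n 1, F p = 0)
    {z : SpaceTime n} (hz : z.2 < 1) (p : SpaceTime n) :
    F p * kext s (z - p) = F p * kcut s (z - p) := by
  by_cases hp : p ∈ Qtilde n 1
  · rw [kcut, indicator_of_mem]
    have := hp.2.1
    simp only [mem_ofPred_eq, Prod.snd_sub]
    linarith
  · rw [hF p hp, zero_mul, zero_mul]

theorem snd_lt_one_of_mem_Q {r : ℝ} {z : SpaceTime n} (hz : z ∈ Q n r) : z.2 < 1 :=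
  hz.2.2.trans_lt one_pos

theorem ae_integrable_pot {s : ℝ} (hs : 0 < s) {F : SpaceTime n → ℝ} (hFi : Integrable F)
    (hF : ∀ p ∉ Qtilde n 1, F p = 0) {r : ℝ} :
    ∀ᵐ z ∂(volume.restrict (Q n r)), Integrable fun p => F p * kext s (z - p) := by
  have h := (hFi.ae_convolution_exists (ContinuousLinearMap.mul ℝ ℝ)
    (integrable_kcut (n := n) hs))
  rw [ae_restrict_iff' (measurableSet_Q r)]
  filter_upwards [h] with z hz hzQ
  have : Integrable fun p => F p * kcut s (z - p) := hz
  simpa only [mul_kext_eq_mul_kcut s hF (snd_lt_one_of_mem_Q hzQ)] using this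

theorem aestronglyMeasurable_pot {s : ℝ} (hs : 0 < s) {F : SpaceTime n → ℝ} (hFi : Integrable F)
    (hF : ∀ p ∉ Qtilde n 1, F p = 0) {r : ℝ} :
    AEStronglyMeasurable (pot s F) (volume.restrict (Q n r)) := by
  have h := (hFi.integrable_convolution (ContinuousLinearMap.mul ℝ ℝ)
    (integrable_kcut (n := n) hs)).aestronglyMeasurable.restrict (s := Q n r)
  refine h.congr ?_
  rw [Filter.EventuallyEq, ae_restrict_iff' (measurableSet_Q r)]
  refine Filter.Eventually.of_forall fun z hz => ?_
  simp only [pot, mul_kext_eq_mul_kcut s hF (snd_lt_one_of_mem_Q hz)]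
  rfl

/-- The weighted integral `∫_{Q₁} |g| |p|^{-γ} wt(ρ/|p|) dp` which bounds the deviation of the
potential of `g` from its Taylor polynomial at scale `ρ`. It is nondecreasing in `ρ`. -/
def Phi (s : ℝ) (N : ℕ) (g : SpaceTime n → ℝ) (r : ℝ) : ℝ≥0∞ :=
  ∫⁻ p in Q n 1, ‖g p‖ₑ * ENNReal.ofReal (pnorm p ^ (-gam n s) * wt N (r / pnorm p))

theorem Phi_mono (s : ℝ) (N : ℕ) (g : SpaceTime n → ℝ) {r r' : ℝ} (hr : 0 ≤ r) (h : r ≤ r') :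
    Phi s N g r ≤ Phi s N g r' := by
  refine lintegral_mono fun p => ?_
  have h0 := pnorm_nonneg p
  have : wt N (r / pnorm p) ≤ wt N (r' / pnorm p) := wt_mono N (by positivity) (by gcongr)
  have : 0 ≤ pnorm p ^ (-gam n s) := by positivity
  gcongr

theorem ae_pnorm_pos : ∀ᵐ p : SpaceTime n, 0 < pnorm p := by
  have : (volume : Measure (SpaceTime n)) {0} = 0 := measure_singleton 0
  filter_upwards [compl_mem_ae_iff.2 this] with p hp
  exact pnorm_pos_iff.2 hp

/-- The potential of `g` deviates from a parabolic polynomial, whose coefficients are the integrals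
of `g` against those of the kernel, by at most `Phi`. -/
theorem exists_pot_approx (n : ℕ) {s : ℝ} (hs : 0 < s) (hs₁ : s < 1) (N : ℕ) :
    ∃ D : ℝ, 0 ≤ D ∧ ∀ g : SpaceTime n → ℝ, Integrable ((Q n 1).indicator g) →
      Phi s N g 1 ≠ ⊤ → ∃ b : (Fin n → ℕ) × ℕ → ℝ,
        (∀ σ ∈ multiIndices n N, |b σ| ≤ D * (Phi s N g 1).toReal) ∧
        ∀ r, 0 < r → ∫⁻ z in Q n r,
          ‖pot s ((Q n 1).indicator g) z - ∑ σ ∈ multiIndices n N, b σ * mono σ z‖ₑ ≤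
            ENNReal.ofReal (D * (ballVol n * r ^ (n + 2))) * Phi s N g r := by
  obtain ⟨c, C, hC0, hcm, hc, hT⟩ := exists_kernel_expansion n s N
  obtain ⟨D, hD0, hD⟩ := lintegral_remainder_le hs hs₁ hC0 hc hT
  refine ⟨C + D, by positivity, fun g hg hPhi => ?_⟩
  set F := (Q n 1).indicator g with hF
  have hFsupp : ∀ p ∉ Qtilde n 1, F p = 0 := fun p hp =>
    indicator_of_notMem (fun h => hp (Q_one_subset h)) _
  have hcoef : ∀ σ ∈ multiIndices n N,
      ∫⁻ p, ‖F p * c σ p‖ₑ ≤ ENNReal.ofReal C * Phi s N g 1 := by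
    intro σ hσ
    rw [Phi, ← lintegral_const_mul' _ _ ENNReal.ofReal_ne_top,
      ← lintegral_indicator (measurableSet_Q 1)]
    refine lintegral_mono_ae ?_
    filter_upwards [ae_pnorm_pos] with p hp
    by_cases hpQ : p ∈ Q n 1
    · rw [indicator_of_mem hpQ, hF, indicator_of_mem hpQ, enorm_mul, mul_left_comm,
        ← ENNReal.ofReal_mul hC0, Real.enorm_eq_ofReal_abs (c σ p)]
      refine mul_le_mul_right (ENNReal.ofReal_le_ofReal ((hc σ hσ p hp).trans ?_)) _
      have hp1 : 1 ≤ 1 / pnorm p := by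
        rw [le_div_iff₀ hp, one_mul]; exact ((mem_Q_iff one_pos).1 hpQ).1.le
      rw [wt, min_eq_left hp1, mul_one, ← one_div]
      have := mem_multiIndices_iff_deg.1 hσ
      gcongr
    · rw [hF, indicator_of_notMem hpQ, zero_mul, enorm_zero]
      exact bot_le
  have hcint : ∀ σ ∈ multiIndices n N, Integrable fun p => F p * c σ p := fun σ hσ =>
    ⟨hg.aestronglyMeasurable.mul (hcm σ).aestronglyMeasurable,
      (hcoef σ hσ).trans_lt (ENNReal.mul_lt_top ENNReal.ofReal_lt_top hPhi.lt_top)⟩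
  refine ⟨fun σ => ∫ p, F p * c σ p, fun σ hσ => ?_, fun r hr => ?_⟩
  · have h1 : ‖∫ p, F p * c σ p‖ₑ ≤ ENNReal.ofReal C * Phi s N g 1 :=
      (enorm_integral_le_lintegral_enorm _).trans (hcoef σ hσ)
    have h2 := ENNReal.toReal_mono (ENNReal.mul_ne_top ENNReal.ofReal_ne_top hPhi) h1
    rw [ENNReal.toReal_mul, ENNReal.toReal_ofReal hC0, toReal_enorm, Real.norm_eq_abs] at h2
    refine h2.trans ?_
    gcongr
    linarith
  set rem : SpaceTime n → SpaceTime n → ℝ :=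
    fun z p => kext s (z - p) - ∑ σ ∈ multiIndices n N, c σ p * mono σ z with hrem
  have hremm : Measurable (Function.uncurry rem) := by
    have h1 := (measurable_kext (n := n) s).comp (measurable_fst.sub measurable_snd)
    refine h1.sub (Finset.measurable_sum _ fun σ _ => ?_)
    exact ((hcm σ).comp measurable_snd).mul ((continuous_mono σ).measurable.comp measurable_fst)
  have hrep : ∀ᵐ z ∂(volume.restrict (Q n r)),
      pot s F z - ∑ σ ∈ multiIndices n N, (∫ p, F p * c σ p) * mono σ z = ∫ p, F p * rem z p := by
    filter_upwards [ae_integrable_pot hs hg hFsupp] with z hz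
    have h1 : ∀ p, F p * rem z p =
        F p * kext s (z - p) - ∑ σ ∈ multiIndices n N, F p * c σ p * mono σ z := by
      intro p
      rw [hrem, mul_sub, Finset.mul_sum]
      simp only [mul_assoc]
    simp only [h1]
    rw [integral_sub hz (integrable_finsetSum _ fun σ hσ => (hcint σ hσ).mul_const _),
      integral_finsetSum _ fun σ hσ => (hcint σ hσ).mul_const _]
    simp only [integral_mul_const, pot]
  calc _ ≤ ∫⁻ z in Q n r, ∫⁻ p, ‖F p‖ₑ * ‖rem z p‖ₑ := by
        refine lintegral_mono_ae ?_
        filter_upwards [hrep] with z hz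
        rw [hz]
        refine (enorm_integral_le_lintegral_enorm _).trans_eq ?_
        simp only [enorm_mul]
    _ = ∫⁻ p, ∫⁻ z in Q n r, ‖F p‖ₑ * ‖rem z p‖ₑ := by
        refine lintegral_lintegral_swap ?_
        exact (hg.aestronglyMeasurable.comp_snd.enorm).mul hremm.enorm.aemeasurable
    _ = ∫⁻ p, ‖F p‖ₑ * ∫⁻ z in Q n r, ‖rem z p‖ₑ := by
        refine lintegral_congr fun p => lintegral_const_mul' _ _ enorm_ne_top
    _ ≤ ∫⁻ p, (Q n 1).indicator (fun p => ‖g p‖ₑ * ENNReal.ofReal (D * (ballVol n * r ^ (n + 2)) *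
          (pnorm p ^ (-gam n s) * wt N (r / pnorm p)))) p := by
        refine lintegral_mono_ae ?_
        filter_upwards [ae_pnorm_pos] with p hp
        by_cases hpQ : p ∈ Q n 1
        · rw [indicator_of_mem hpQ, hF, indicator_of_mem hpQ]
          exact mul_le_mul_right (hD p r hp hr) _
        · rw [hF, indicator_of_notMem hpQ, enorm_zero, zero_mul]
          exact bot_le
    _ = ENNReal.ofReal (D * (ballVol n * r ^ (n + 2))) * Phi s N g r := by
        have hv := ballVol_pos (n := n)
        rw [lintegral_indicator (measurableSet_Q 1), Phi,
          ← lintegral_const_mul' _ _ ENNReal.ofReal_ne_top]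
        refine lintegral_congr fun p => ?_
        rw [ENNReal.ofReal_mul (p := D * _) (by positivity), mul_left_comm]
    _ ≤ _ := by
        have hv := ballVol_pos (n := n)
        gcongr
        linarith

/-! ### Potentials of polynomials -/

/-- A smooth cutoff equal to `1` on the ball of radius `1/2`, supported in the unit ball. -/
def innerBump (n : ℕ) : ContDiffBump (0 : SpaceTime n) := ⟨1 / 2, 1, by norm_num, by norm_num⟩

/-- A smooth cutoff equal to `1` on the ball of radius `3`, with compact support. -/
def outerBump (n : ℕ) : ContDiffBump (0 : SpaceTime n) := ⟨3, 4, by norm_num, by norm_num⟩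

/-- The potential of a monomial on the unit cylinder is smooth near the origin. The part of the
density near the origin is smooth and compactly supported; the other part only sees the kernel away
from its pole. -/
theorem exists_contDiff_pot_mono {s : ℝ} (hs : 0 < s) (σ : (Fin n → ℕ) × ℕ) :
    ∃ H : SpaceTime n → ℝ, (∀ m : ℕ, ContDiff ℝ m H) ∧
      ∀ z, ‖z‖ < 1 / 4 → pot s ((Qtilde n 1).indicator (mono σ)) z = H z := by
  set L := ContinuousLinearMap.mul ℝ ℝ
  set f₁ : SpaceTime n → ℝ := fun p => innerBump n p * mono σ p with hf₁
  set f₂ : SpaceTime n → ℝ :=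
    (Qtilde n 1).indicator fun p => (1 - innerBump n p) * mono σ p with hf₂
  set G : SpaceTime n → ℝ := fun z => outerBump n z * regKernel s z with hG
  have hf₁s : ∀ m : ℕ, ContDiff ℝ m f₁ := fun m => (innerBump n).contDiff.mul (contDiff_mono σ)
  have hf₁c : HasCompactSupport f₁ := (innerBump n).hasCompactSupport.mul_right
  have hGs : ∀ m : ℕ, ContDiff ℝ m G := fun m =>
    (outerBump n).contDiff.mul (contDiff_regKernel s m)
  have hGc : HasCompactSupport G := (outerBump n).hasCompactSupport.mul_right
  have hk : LocallyIntegrable (kcut s : SpaceTime n → ℝ) := (integrable_kcut hs).locallyIntegrable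
  have hf₂i : LocallyIntegrable f₂ := by
    refine Continuous.locallyIntegrable (X := SpaceTime n) (f := fun p =>
      (1 - innerBump n p) * mono σ p) ?_ |>.indicator (measurableSet_Qtilde 1)
    exact (continuous_const.sub (innerBump n).continuous).mul (continuous_mono σ)
  refine ⟨fun z => convolution f₁ (kcut s) L volume z + convolution f₂ G L volume z,
    fun m => ?_, fun z hz => ?_⟩
  · exact (hf₁c.contDiff_convolution_left (n := (m : ℕ∞)) L (hf₁s m) hk).add
      (hGc.contDiff_convolution_right (n := (m : ℕ∞)) L hf₂i (hGs m))
  · have h₁ : Integrable fun p => f₁ p * kcut s (z - p) :=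
      hf₁c.convolutionExists_left L (hf₁s 0).continuous hk z
    have h₂ : Integrable fun p => f₂ p * G (z - p) :=
      hGc.convolutionExists_right L hf₂i (hGs 0).continuous z
    change _ = (∫ p, f₁ p * kcut s (z - p)) + ∫ p, f₂ p * G (z - p)
    rw [← integral_add h₁ h₂, pot]
    refine integral_congr_ae (Filter.Eventually.of_forall fun p => ?_)
    have hz2 : |z.2| < 1 / 4 := (norm_snd_le z).trans_lt hz
    by_cases hp : p ∈ Qtilde n 1
    · have hp1 : ‖p‖ < 1 := by rwa [Qtilde_one, mem_ball_zero_iff] at hp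
      have hp2 : |p.2| < 1 := (norm_snd_le p).trans_lt hp1
      have hkc : kcut s (z - p) = kext s (z - p) := by
        rw [kcut, indicator_of_mem]
        simp only [mem_ofPred_eq, Prod.snd_sub]
        linarith [(abs_lt.1 hz2).2, (abs_lt.1 hp2).1]
      have hGk : (1 - innerBump n p) * G (z - p) = (1 - innerBump n p) * kext s (z - p) := by
        rcases le_or_gt ‖p‖ (1 / 2) with h | h
        · rw [(innerBump n).one_of_mem_closedBall (mem_closedBall_zero_iff.2 h), sub_self, zero_mul,
            zero_mul]
        · have h3 : ‖z - p‖ ≤ 3 := (norm_sub_le z p).trans (by linarith)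
          have h4 : 1 / 4 ≤ ‖z - p‖ := by
            rw [norm_sub_rev]
            linarith [norm_sub_norm_le p z]
          simp only [hG]
          rw [(outerBump n).one_of_mem_closedBall (mem_closedBall_zero_iff.2 h3), one_mul,
            regKernel_eq s h4]
      simp only [hf₁, hf₂, indicator_of_mem hp, hkc]
      linear_combination (-mono σ p) * hGk
    · have hp1 : 1 ≤ ‖p‖ := by rwa [Qtilde_one, mem_ball_zero_iff, not_lt] at hp
      simp only [hf₁, hf₂, indicator_of_notMem hp]
      rw [(innerBump n).zero_of_le_dist (by rwa [dist_zero_right])]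
      ring

theorem abs_mono_le_one (σ : (Fin n → ℕ) × ℕ) {p : SpaceTime n} (hp : p ∈ Qtilde n 1) :
    |mono σ p| ≤ 1 :=
  (abs_mono_le σ p).trans (pow_le_one₀ (pnorm_nonneg p) ((mem_Qtilde_iff one_pos).1 hp).le)

theorem integrable_mono_mul_kext {s : ℝ} (hs : 0 < s) (σ : (Fin n → ℕ) × ℕ) {z : SpaceTime n}
    (hz : z.2 < 1) :
    Integrable (fun p => (Qtilde n 1).indicator (mono σ) p * kext s (z - p)) ∧
      |pot s ((Qtilde n 1).indicator (mono σ)) z| ≤ ∫ p : SpaceTime n, kcut s p := by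
  have hsupp : ∀ p ∉ Qtilde n 1, (Qtilde n 1).indicator (mono σ) p = 0 :=
    fun p hp => indicator_of_notMem hp _
  have hb : ∀ p, ‖(Qtilde n 1).indicator (mono σ) p‖ ≤ 1 := by
    intro p
    by_cases hp : p ∈ Qtilde n 1
    · rw [indicator_of_mem hp]; exact abs_mono_le_one σ hp
    · rw [indicator_of_notMem hp, norm_zero]; exact zero_le_one
  have hi : Integrable fun p => kcut s (z - p) := (integrable_kcut hs).comp_sub_left z
  have hm : AEStronglyMeasurable ((Qtilde n 1).indicator (mono σ) : SpaceTime n → ℝ) :=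
    ((continuous_mono σ).measurable.indicator (measurableSet_Qtilde 1)).aestronglyMeasurable
  simp only [pot, mul_kext_eq_mul_kcut s hsupp hz]
  refine ⟨hi.bdd_mul hm (Filter.Eventually.of_forall hb), ?_⟩
  rw [← integral_sub_left_eq_self (fun p => kcut s p) volume z, ← Real.norm_eq_abs]
  refine norm_integral_le_of_norm_le hi (Filter.Eventually.of_forall fun p => ?_)
  rw [norm_mul, Real.norm_of_nonneg (kcut_nonneg s (z - p))]
  exact mul_le_of_le_one_left (kcut_nonneg s (z - p)) (hb p)

theorem exists_pot_mono_approx {s : ℝ} (hs : 0 < s) (N : ℕ) (σ : (Fin n → ℕ) × ℕ) :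
    ∃ (b : (Fin n → ℕ) × ℕ → ℝ) (E : ℝ), 0 ≤ E ∧ ∀ z ∈ Q n (1 / 2),
      |pot s ((Qtilde n 1).indicator (mono σ)) z - ∑ τ ∈ multiIndices n N, b τ * mono τ z| ≤
        E * pnorm z ^ (N + 1) := by
  obtain ⟨H, hH, hpot⟩ := exists_contDiff_pot_mono (n := n) hs σ
  obtain ⟨c, -, hT⟩ := exists_taylor N hH
  obtain ⟨E, hE0, hE⟩ := hT 1
  set A := (∫ p : SpaceTime n, kcut s p) + ∑ τ ∈ multiIndices n N, |c τ 0| with hA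
  have hA0 : 0 ≤ A := add_nonneg (integral_nonneg fun p => kcut_nonneg s p)
    (Finset.sum_nonneg fun τ _ => abs_nonneg _)
  refine ⟨fun τ => c τ 0, E + A * 4 ^ (N + 1), by positivity, fun z hz => ?_⟩
  have hz1 : pnorm z ≤ 1 := by linarith [((mem_Q_iff (by norm_num)).1 hz).1]
  have hz0 := pnorm_nonneg z
  rcases lt_or_ge ‖z‖ (1 / 4) with h | h
  · have := hE 0 z (by simp [pnorm]) hz1
    rw [zero_add] at this
    rw [hpot z h]
    refine this.trans ?_
    gcongr
    exact le_add_of_nonneg_right (by positivity)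
  -- away from the origin the potential and the polynomial are merely bounded
  · have h1 : 1 / 4 ≤ pnorm z := by
      have := norm_le_of_pnorm_le hz1 le_rfl
      linarith
    have h2 : |∑ τ ∈ multiIndices n N, c τ 0 * mono τ z| ≤ ∑ τ ∈ multiIndices n N, |c τ 0| := by
      refine (Finset.abs_sum_le_sum_abs _ _).trans (Finset.sum_le_sum fun τ _ => ?_)
      rw [abs_mul]
      exact mul_le_of_le_one_right (abs_nonneg _)
        ((abs_mono_le τ z).trans (pow_le_one₀ hz0 hz1))
    have h3 : 1 ≤ 4 ^ (N + 1) * pnorm z ^ (N + 1) := by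
      rw [← mul_pow]; exact one_le_pow₀ (by linarith)
    calc _ ≤ A := (abs_sub _ _).trans
          (add_le_add (integrable_mono_mul_kext hs σ (snd_lt_one_of_mem_Q hz)).2 h2)
      _ ≤ A * (4 ^ (N + 1) * pnorm z ^ (N + 1)) := le_mul_of_one_le_right hA0 h3
      _ ≤ (E + A * 4 ^ (N + 1)) * pnorm z ^ (N + 1) := by
          have : 0 ≤ E * pnorm z ^ (N + 1) := by positivity
          linarith

/-! ### Approximation of the internal part -/

theorem indicator_integrand (s : ℝ) (f : SpaceTime n → ℝ) {z : SpaceTime n} (hz : z.2 ≤ 0) :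
    (univ ×ˢ Iio z.2).indicator (integrand s f z) =
      fun p => (Q n 1).indicator f p * kext s (z - p) := by
  funext p
  by_cases hp : p.2 < z.2
  · have hmem : p ∈ (univ ×ˢ Iio z.2 : Set (SpaceTime n)) := ⟨mem_univ _, hp⟩
    have hk : kext s (z - p) = kernel s (z.1 - p.1) (z.2 - p.2) := if_pos (sub_pos.2 hp)
    have hQ : p ∈ Q n 1 ↔ p ∈ Qtilde n 1 := by
      rw [mem_Q_iff one_pos, mem_Qtilde_iff one_pos]
      exact and_iff_left (by linarith)
    rw [indicator_of_mem hmem, integrand, hk]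
    by_cases h : p ∈ Qtilde n 1
    · rw [indicator_of_mem h, indicator_of_mem (hQ.2 h)]
    · rw [indicator_of_notMem h, indicator_of_notMem (hQ.not.2 h)]
  · have hmem : p ∉ (univ ×ˢ Iio z.2 : Set (SpaceTime n)) := fun h => hp h.2
    have hk : kext s (z - p) = 0 := if_neg (fun h => hp (sub_pos.1 h))
    rw [indicator_of_notMem hmem, hk, mul_zero]

theorem measurableSet_past (t : ℝ) :
    MeasurableSet (univ ×ˢ Iio t : Set (SpaceTime n)) := MeasurableSet.univ.prod measurableSet_Iio

theorem w₁_eq_pot (s : ℝ) (f : SpaceTime n → ℝ) {z : SpaceTime n} (hz : z.2 ≤ 0) :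
    w₁ s f z = pot s ((Q n 1).indicator f) z := by
  rw [w₁, ← integral_indicator (measurableSet_past _), indicator_integrand s f hz, pot]

theorem indicator_Q_one_eq_zero (f : SpaceTime n → ℝ) :
    ∀ p ∉ Qtilde n 1, (Q n 1).indicator f p = 0 := fun _ hp =>
  indicator_of_notMem (fun h => hp (Q_one_subset h)) _

theorem ae_integrableOn_integrand {s : ℝ} (hs : 0 < s) {f : SpaceTime n → ℝ}
    (hf : IntegrableOn f (Q n 1)) (r : ℝ) :
    ∀ᵐ z ∂(volume.restrict (Q n r)), IntegrableOn (integrand s f z) (univ ×ˢ Iio z.2) volume := by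
  filter_upwards [ae_integrable_pot (r := r) hs
    ((integrable_indicator_iff (measurableSet_Q 1)).2 hf) (indicator_Q_one_eq_zero f),
    ae_restrict_mem (measurableSet_Q r)] with z hz hzQ
  rw [← integrable_indicator_iff (measurableSet_past _), indicator_integrand s f hzQ.2.2]
  exact hz

theorem aestronglyMeasurable_w₁ {s : ℝ} (hs : 0 < s) {f : SpaceTime n → ℝ}
    (hf : IntegrableOn f (Q n 1)) (r : ℝ) :
    AEStronglyMeasurable (w₁ s f) (volume.restrict (Q n r)) := by
  refine (aestronglyMeasurable_pot (r := r) hs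
    ((integrable_indicator_iff (measurableSet_Q 1)).2 hf) (indicator_Q_one_eq_zero f)).congr ?_
  filter_upwards [ae_restrict_mem (measurableSet_Q r)] with z hzQ
  exact (w₁_eq_pot s f hzQ.2.2).symm

theorem polyNorm_nonneg (k : ℕ) (a : (Fin n → ℕ) × ℕ → ℝ) : 0 ≤ polyNorm k a :=
  Finset.sum_nonneg fun _ _ => abs_nonneg _

theorem multiIndices_mono {N M : ℕ} (h : N ≤ M) : multiIndices n N ⊆ multiIndices n M :=
  fun _ hσ => mem_multiIndices_iff_deg.2 ((mem_multiIndices_iff_deg.1 hσ).trans h)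

theorem parabolicPoly_eq_of_le {N M : ℕ} (h : N ≤ M) {b : (Fin n → ℕ) × ℕ → ℝ}
    (hb : ∀ σ ∉ multiIndices n N, b σ = 0) :
    (parabolicPoly M b : SpaceTime n → ℝ) = parabolicPoly N b := by
  funext z
  rw [parabolicPoly_eq_sum_fct, parabolicPoly_eq_sum_fct]
  exact (Finset.sum_subset (multiIndices_mono h) fun σ _ hσ => by
    rw [hb σ hσ, zero_div, zero_mul]).symm

theorem polyNorm_eq_of_le {N M : ℕ} (h : N ≤ M) {b : (Fin n → ℕ) × ℕ → ℝ}
    (hb : ∀ σ ∉ multiIndices n N, b σ = 0) : polyNorm M b = polyNorm N b :=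
  (Finset.sum_subset (multiIndices_mono h) fun σ _ hσ => by rw [hb σ hσ, abs_zero]).symm

theorem pot_indicator_parabolicPoly {s : ℝ} (hs : 0 < s) (k : ℕ) (a : (Fin n → ℕ) × ℕ → ℝ)
    {z : SpaceTime n} (hz : z.2 ≤ 0) :
    Integrable (fun p => (Q n 1).indicator (parabolicPoly k a) p * kext s (z - p)) ∧
      pot s ((Q n 1).indicator (parabolicPoly k a)) z =
        ∑ σ ∈ multiIndices n k, a σ / fct σ * pot s ((Qtilde n 1).indicator (mono σ)) z := by
  have h : ∀ p, (Q n 1).indicator (parabolicPoly k a) p * kext s (z - p) =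
      ∑ σ ∈ multiIndices n k,
        a σ / fct σ * ((Qtilde n 1).indicator (mono σ) p * kext s (z - p)) := by
    intro p
    by_cases hp : p.2 < z.2
    · have hQ : p ∈ Q n 1 ↔ p ∈ Qtilde n 1 := by
        rw [mem_Q_iff one_pos, mem_Qtilde_iff one_pos]
        exact and_iff_left (by linarith)
      by_cases h : p ∈ Qtilde n 1
      · simp only [indicator_of_mem h, indicator_of_mem (hQ.2 h), parabolicPoly_eq_sum_fct,
          Finset.sum_mul, mul_assoc]
      · simp only [indicator_of_notMem h, indicator_of_notMem (hQ.not.2 h), zero_mul, mul_zero,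
          Finset.sum_const_zero]
    · have hk : kext s (z - p) = 0 := if_neg (fun h => hp (sub_pos.1 h))
      simp only [hk, mul_zero, Finset.sum_const_zero]
  have hi := fun σ : (Fin n → ℕ) × ℕ =>
    (integrable_mono_mul_kext hs σ (show z.2 < 1 by linarith)).1
  simp only [pot, h]
  refine ⟨integrable_finsetSum _ fun σ _ => (hi σ).const_mul _, ?_⟩
  rw [integral_finsetSum _ fun σ _ => (hi σ).const_mul _]
  simp only [integral_const_mul]

/-- The approximation of `w₁`, for a density `f` with deviation `g` from a polynomial. -/
theorem exists_w₁_approx (n k : ℕ) {s : ℝ} (hs : 0 < s) (hs₁ : s < 1) (N : ℕ) :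
    ∃ D : ℝ, 0 ≤ D ∧ ∀ (f : SpaceTime n → ℝ) (a : (Fin n → ℕ) × ℕ → ℝ),
      IntegrableOn (fun z => f z - parabolicPoly k a z) (Q n 1) →
      Phi s N (fun z => f z - parabolicPoly k a z) 1 ≠ ⊤ →
      ∃ b : (Fin n → ℕ) × ℕ → ℝ, (∀ σ ∉ multiIndices n N, b σ = 0) ∧
        polyNorm N b ≤
          D * ((Phi s N (fun z => f z - parabolicPoly k a z) 1).toReal + polyNorm k a) ∧
        ∀ r, 0 < r → r ≤ 1 / 2 → meanOsc (w₁ s f) (parabolicPoly N b) r ≤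
          ENNReal.ofReal D * (Phi s N (fun z => f z - parabolicPoly k a z) r +
            ENNReal.ofReal (polyNorm k a * r ^ (N + 1))) := by
  classical
  obtain ⟨D, hD0, hD⟩ := exists_pot_approx n hs hs₁ N
  choose β E hE0 hE using fun σ => exists_pot_mono_approx (n := n) hs N σ
  set E' := ∑ σ ∈ multiIndices n k, E σ with hE'
  have hE'0 : 0 ≤ E' := Finset.sum_nonneg fun σ _ => hE0 σ
  set B' := ∑ τ ∈ multiIndices n N, ∑ σ ∈ multiIndices n k, |β σ τ| with hB'
  have hB'0 : 0 ≤ B' := Finset.sum_nonneg fun τ _ => Finset.sum_nonneg fun σ _ => abs_nonneg _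
  set S := ∑ τ ∈ multiIndices n N, fct τ with hS
  have hS0 : 0 ≤ S := Finset.sum_nonneg fun τ _ => zero_le_one.trans (one_le_fct τ)
  refine ⟨D + E' + S * (D + B'), by positivity, fun f a hg hPhi => ?_⟩
  set g : SpaceTime n → ℝ := fun z => f z - parabolicPoly k a z with hgdef
  have hgi : Integrable ((Q n 1).indicator g) :=
    (integrable_indicator_iff (measurableSet_Q 1)).2 hg
  obtain ⟨b, hb, hbr⟩ := hD g hgi hPhi
  have hdiv : ∀ σ, |a σ / fct σ| ≤ |a σ| := by
    intro σ
    rw [abs_div, abs_of_pos (zero_lt_one.trans_le (one_le_fct σ))]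
    exact div_le_self (abs_nonneg _) (one_le_fct σ)
  have ha : ∀ σ ∈ multiIndices n k, |a σ| ≤ polyNorm k a := fun σ hσ =>
    Finset.single_le_sum (f := fun σ => |a σ|) (fun _ _ => abs_nonneg _) hσ
  have hP0 := polyNorm_nonneg k a
  have hT0 : 0 ≤ (Phi s N g 1).toReal := ENNReal.toReal_nonneg
  set b' : (Fin n → ℕ) × ℕ → ℝ := fun τ =>
    b τ + ∑ σ ∈ multiIndices n k, a σ / fct σ * β σ τ with hb'
  -- `parabolicPoly` divides its coefficients by the factorials
  set b'' : (Fin n → ℕ) × ℕ → ℝ := fun τ => if τ ∈ multiIndices n N then fct τ * b' τ else 0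
    with hb''
  have hpoly : ∀ z : SpaceTime n, parabolicPoly N b'' z =
      ∑ τ ∈ multiIndices n N, b τ * mono τ z + ∑ σ ∈ multiIndices n k,
        a σ / fct σ * ∑ τ ∈ multiIndices n N, β σ τ * mono τ z := by
    intro z
    simp only [Finset.mul_sum]
    rw [Finset.sum_comm, ← Finset.sum_add_distrib, parabolicPoly_eq_sum_fct]
    refine Finset.sum_congr rfl fun τ hτ => ?_
    have : fct τ ≠ 0 := (zero_lt_one.trans_le (one_le_fct τ)).ne'
    simp only [hb'', if_pos hτ, hb']
    rw [mul_div_cancel_left₀ _ this, add_mul, Finset.sum_mul]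
    simp only [mul_assoc]
  refine ⟨b'', fun σ hσ => if_neg hσ, ?_, fun r hr hr2 => ?_⟩
  · have h1 : polyNorm N b'' ≤
        ∑ τ ∈ multiIndices n N, fct τ * ((D + B') * ((Phi s N g 1).toReal + polyNorm k a)) := by
      refine Finset.sum_le_sum fun τ hτ => ?_
      have hf0 := zero_lt_one.trans_le (one_le_fct τ)
      simp only [hb'', if_pos hτ]
      rw [abs_mul, abs_of_pos hf0]
      refine mul_le_mul_of_nonneg_left ?_ hf0.le
      have h2 : |∑ σ ∈ multiIndices n k, a σ / fct σ * β σ τ| ≤ B' * polyNorm k a := by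
        calc _ ≤ ∑ σ ∈ multiIndices n k, |β σ τ| * polyNorm k a := by
              refine (Finset.abs_sum_le_sum_abs _ _).trans (Finset.sum_le_sum fun σ hσ => ?_)
              rw [abs_mul, mul_comm]
              exact mul_le_mul_of_nonneg_left ((hdiv σ).trans (ha σ hσ)) (abs_nonneg _)
          _ ≤ _ := by
              rw [← Finset.sum_mul]
              refine mul_le_mul_of_nonneg_right ?_ hP0
              exact Finset.single_le_sum (f := fun τ => ∑ σ ∈ multiIndices n k, |β σ τ|)
                (fun τ _ => Finset.sum_nonneg fun σ _ => abs_nonneg _) hτ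
      refine (abs_add_le _ _).trans ((add_le_add (hb τ hτ) h2).trans ?_)
      have := mul_nonneg hD0 hP0
      have := mul_nonneg hB'0 hT0
      linarith
    rw [← Finset.sum_mul] at h1
    refine h1.trans ?_
    rw [← mul_assoc]
    refine mul_le_mul_of_nonneg_right ?_ (add_nonneg hT0 hP0)
    linarith
  · have hv := ballVol_pos (n := n)
    set V := ballVol n * r ^ (n + 2) with hV
    have hV0 : 0 < V := by positivity
    have hae : ∀ᵐ z ∂(volume.restrict (Q n r)), ‖w₁ s f z - parabolicPoly N b'' z‖ₑ ≤
        ‖pot s ((Q n 1).indicator g) z - ∑ τ ∈ multiIndices n N, b τ * mono τ z‖ₑ +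
          ENNReal.ofReal (E' * (polyNorm k a * r ^ (N + 1))) := by
      filter_upwards [ae_integrable_pot (r := r) hs hgi (indicator_Q_one_eq_zero g),
        ae_restrict_mem (measurableSet_Q r)] with z hz hzQ
      have hzr := (mem_Q_iff hr).1 hzQ
      obtain ⟨hPi, hPp⟩ := pot_indicator_parabolicPoly hs k a hzr.2
      have hsplit : w₁ s f z = pot s ((Q n 1).indicator g) z +
          ∑ σ ∈ multiIndices n k, a σ / fct σ * pot s ((Qtilde n 1).indicator (mono σ)) z := by
        rw [w₁_eq_pot s f hzr.2, ← hPp, pot, pot, pot, ← integral_add hz hPi]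
        refine integral_congr_ae (Filter.Eventually.of_forall fun p => ?_)
        by_cases hp : p ∈ Q n 1
        · simp only [indicator_of_mem hp, hgdef]; ring
        · simp only [indicator_of_notMem hp]; ring
      rw [hsplit, hpoly, add_sub_add_comm, ← Finset.sum_sub_distrib]
      refine (enorm_add_le _ _).trans (add_le_add le_rfl ?_)
      rw [Real.enorm_eq_ofReal_abs]
      refine ENNReal.ofReal_le_ofReal ?_
      rw [hE', Finset.sum_mul]
      refine (Finset.abs_sum_le_sum_abs _ _).trans (Finset.sum_le_sum fun σ hσ => ?_)
      have hzh : z ∈ Q n (1 / 2) :=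
        (mem_Q_iff (by norm_num)).2 ⟨hzr.1.trans_le hr2, hzr.2⟩
      have h1 := pow_le_pow_left₀ (pnorm_nonneg z) hzr.1.le (N + 1)
      rw [← mul_sub, abs_mul]
      calc _ ≤ polyNorm k a * (E σ * r ^ (N + 1)) :=
            mul_le_mul ((hdiv σ).trans (ha σ hσ))
              ((hE σ z hzh).trans (mul_le_mul_of_nonneg_left h1 (hE0 σ))) (abs_nonneg _) hP0
        _ = _ := by ring
    rw [meanOsc_eq _ _ hr, ← hV]
    refine ENNReal.div_le_of_le_mul ?_
    calc _ ≤ ∫⁻ z in Q n r, (‖pot s ((Q n 1).indicator g) z -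
            ∑ τ ∈ multiIndices n N, b τ * mono τ z‖ₑ +
          ENNReal.ofReal (E' * (polyNorm k a * r ^ (N + 1)))) := lintegral_mono_ae hae
      _ ≤ ENNReal.ofReal (D * V) * Phi s N g r +
          ENNReal.ofReal (E' * (polyNorm k a * r ^ (N + 1))) * ENNReal.ofReal V := by
          rw [lintegral_add_right _ measurable_const, setLIntegral_const, volume_Q hr]
          exact add_le_add (hbr r hr) le_rfl
      _ = (ENNReal.ofReal D * Phi s N g r +
          ENNReal.ofReal E' * ENNReal.ofReal (polyNorm k a * r ^ (N + 1))) *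
            ENNReal.ofReal V := by
          rw [ENNReal.ofReal_mul hD0, ENNReal.ofReal_mul hE'0]
          ring
      _ ≤ _ := by
          have hSB : 0 ≤ S * (D + B') := by positivity
          rw [mul_add]
          gcongr <;> linarith

/-! ### Geometrically weighted sums -/

/-- The sum of the sequence `a` weighted geometrically by the distance to `m`, with ratio `q₁` to
the right of `m` and `q₂` to its left. -/
def dsum (q₁ q₂ : ℝ≥0∞) (a : ℕ → ℝ≥0∞) (m : ℕ) : ℝ≥0∞ :=
  ∑ i ∈ Finset.range m, q₂ ^ (m - i) * a i + ∑' j, q₁ ^ j * a (j + m)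

/-- The sum `∑ (j + 1) q^j`. -/
def wgeom (q : ℝ≥0∞) : ℝ≥0∞ := ∑' j : ℕ, q ^ j * (j + 1)

theorem wgeom_ne_top {q : ℝ} (h0 : 0 ≤ q) (h1 : q < 1) : wgeom (ENNReal.ofReal q) ≠ ⊤ := by
  have hs : Summable fun j : ℕ => q ^ j * ((j : ℝ) + 1) := by
    have hq : ‖q‖ < 1 := by rwa [Real.norm_of_nonneg h0]
    have h2 := summable_pow_mul_geometric_of_norm_lt_one 1 hq
    have h3 := summable_geometric_of_norm_lt_one hq
    refine (h2.add h3).congr fun j => ?_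
    ring
  intro h
  refine hs.tsum_ofReal_ne_top ?_
  rw [← h, wgeom]
  refine tsum_congr fun j => ?_
  rw [ENNReal.ofReal_mul (by positivity), ENNReal.ofReal_pow h0,
    ENNReal.ofReal_add (by positivity) zero_le_one, ENNReal.ofReal_natCast, ENNReal.ofReal_one]

theorem le_dsum_zero (q₁ q₂ : ℝ≥0∞) (a : ℕ → ℝ≥0∞) : a 0 ≤ dsum q₁ q₂ a 0 := by
  refine le_trans ?_ le_add_self
  have := ENNReal.le_tsum (f := fun j => q₁ ^ j * a (j + 0)) 0
  simpa using this

theorem dsum_le_tsum {q₁ q₂ : ℝ≥0∞} (h₁ : q₁ ≤ 1) (h₂ : q₂ ≤ 1) (a : ℕ → ℝ≥0∞) (m : ℕ) :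
    dsum q₁ q₂ a m ≤ ∑' i, a i := by
  rw [← ENNReal.summable.sum_add_tsum_nat_add' (k := m)]
  refine add_le_add (Finset.sum_le_sum fun i _ => ?_) (ENNReal.tsum_le_tsum fun j => ?_)
  · exact mul_le_of_le_one_left' (pow_le_one₀ bot_le h₂)
  · exact mul_le_of_le_one_left' (pow_le_one₀ bot_le h₁)

theorem dsum_le {q₁ q₂ K : ℝ≥0∞} (h₂ : q₂ ≤ 1) {a : ℕ → ℝ≥0∞}
    (ha : ∀ m : ℕ, 1 ≤ m → ∑ i ∈ Finset.range m, a i ≤ K * m) (m : ℕ) :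
    dsum q₁ q₂ a m ≤ K * (1 + wgeom q₁) * (m + 1) := by
  have hleft : ∑ i ∈ Finset.range m, q₂ ^ (m - i) * a i ≤ K * (m + 1) := by
    rcases Nat.eq_zero_or_pos m with rfl | hm
    · simp
    · calc _ ≤ ∑ i ∈ Finset.range m, a i :=
            Finset.sum_le_sum fun i _ => mul_le_of_le_one_left' (pow_le_one₀ bot_le h₂)
        _ ≤ K * m := ha m hm
        _ ≤ K * (m + 1) := by gcongr; exact le_self_add
  have hright : ∑' j, q₁ ^ j * a (j + m) ≤ K * (m + 1) * wgeom q₁ := by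
    rw [wgeom, ← ENNReal.tsum_mul_left]
    refine ENNReal.tsum_le_tsum fun j => ?_
    have h1 : a (j + m) ≤ K * ((m + 1) * (j + 1)) := by
      calc a (j + m) ≤ ∑ i ∈ Finset.range (j + m + 1), a i :=
            Finset.single_le_sum (fun _ _ => bot_le) (Finset.self_mem_range_succ _)
        _ ≤ K * ((j + m + 1 : ℕ) : ℝ≥0∞) := ha _ (by omega)
        _ ≤ K * (((m + 1) * (j + 1) : ℕ) : ℝ≥0∞) := by
            gcongr
            nlinarith [Nat.zero_le (m * j)]
        _ = _ := by push_cast; ring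
    calc _ ≤ q₁ ^ j * (K * ((m + 1) * (j + 1))) := by gcongr
      _ = _ := by ring
  calc _ ≤ K * (m + 1) + K * (m + 1) * wgeom q₁ := add_le_add hleft hright
    _ = _ := by ring

/-- Bounded Cesàro means are preserved by geometric weighting. -/
theorem sum_dsum_le {q₁ q₂ K : ℝ≥0∞} {a : ℕ → ℝ≥0∞} (h₂ : q₂ ≤ 1)
    (ha : ∀ m : ℕ, 1 ≤ m → ∑ i ∈ Finset.range m, a i ≤ K * m) {M : ℕ} (hM : 1 ≤ M) :
    ∑ m ∈ Finset.range M, dsum q₁ q₂ a m ≤ K * (wgeom q₂ + wgeom q₁) * M := by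
  have hleft : ∑ m ∈ Finset.range M, ∑ i ∈ Finset.range m, q₂ ^ (m - i) * a i ≤
      K * M * wgeom q₂ := by
    have hcomm : ∑ m ∈ Finset.range M, ∑ i ∈ Finset.range m, q₂ ^ (m - i) * a i =
        ∑ i ∈ Finset.range M, ∑ m ∈ Finset.Ico (i + 1) M, q₂ ^ (m - i) * a i := by
      refine Finset.sum_comm' fun m i => ?_
      simp only [Finset.mem_range, Finset.mem_Ico]
      omega
    rw [hcomm]
    calc _ ≤ ∑ i ∈ Finset.range M, a i * wgeom q₂ := by
          refine Finset.sum_le_sum fun i _ => ?_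
          rw [← Finset.sum_mul, mul_comm, Finset.sum_Ico_eq_sum_range]
          refine mul_le_mul_right ?_ _
          refine le_trans (Finset.sum_le_sum fun j _ => ?_) (ENNReal.sum_le_tsum _)
          rw [show i + 1 + j - i = j + 1 by omega]
          calc q₂ ^ (j + 1) ≤ q₂ ^ j := pow_le_pow_of_le_one bot_le h₂ (Nat.le_succ j)
            _ ≤ q₂ ^ j * (j + 1) := le_mul_of_one_le_right' le_add_self
      _ ≤ _ := by
          rw [← Finset.sum_mul]
          exact mul_le_mul_left (ha M hM) _
  have hright : ∑ m ∈ Finset.range M, ∑' j, q₁ ^ j * a (j + m) ≤ K * M * wgeom q₁ := by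
    rw [← Summable.tsum_finsetSum fun _ _ => ENNReal.summable, wgeom, ← ENNReal.tsum_mul_left]
    refine ENNReal.tsum_le_tsum fun j => ?_
    have h1 : ∑ m ∈ Finset.range M, a (j + m) ≤ K * (M * (j + 1)) := by
      calc _ ≤ ∑ i ∈ Finset.range (j + M), a i := by
            rw [Finset.sum_range_add]; exact le_add_self
        _ ≤ K * ((j + M : ℕ) : ℝ≥0∞) := ha _ (by omega)
        _ ≤ K * ((M * (j + 1) : ℕ) : ℝ≥0∞) := by
            gcongr
            nlinarith [Nat.mul_le_mul_left j hM]
        _ = _ := by push_cast; ring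
    rw [← Finset.mul_sum]
    calc _ ≤ q₁ ^ j * (K * (M * (j + 1))) := by gcongr
      _ = _ := by ring
  simp only [dsum]
  rw [Finset.sum_add_distrib]
  calc _ ≤ K * M * wgeom q₂ + K * M * wgeom q₁ := add_le_add hleft hright
    _ = _ := by ring

/-! ### The dyadic bound -/

theorem wt_four_mul_le (N : ℕ) {u : ℝ} (hu : 0 ≤ u) : wt N (4 * u) ≤ 4 ^ (N + 1) * wt N u := by
  have h1 : min 1 (4 * u) ≤ 4 * min 1 u := by
    rcases le_total 1 u with h | h
    · rw [min_eq_left h]; exact (min_le_left _ _).trans (by norm_num)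
    · rw [min_eq_right h]; exact min_le_right _ _
  calc wt N (4 * u) = 4 ^ N * u ^ N * min 1 (4 * u) := by rw [wt, mul_pow]
    _ ≤ 4 ^ N * u ^ N * (4 * min 1 u) := by gcongr
    _ = _ := by rw [wt]; ring

/-- `Phi` is bounded by a sum over parabolic annuli. -/
theorem Phi_le_tsum {s : ℝ} (hs₁ : s < 1) (N : ℕ) {g : SpaceTime n → ℝ}
    (hg : AEStronglyMeasurable g (volume.restrict (Q n 1)))
    {r : ℝ} (hr : r ∈ Icc (1 / 4 : ℝ) (1 / 2))
    {R : ℝ} (hR : 0 ≤ R) :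
    Phi s N g R ≤ ∑' i : ℕ, ENNReal.ofReal (4 ^ gam n s * 4 ^ (N + 1) *
      ((r ^ i) ^ (-gam n s) * wt N (R / r ^ i))) * ∫⁻ p in Q n (r ^ i), ‖g p‖ₑ := by
  have hr0 : 0 < r := by linarith [hr.1]
  have hr1 : r < 1 := by linarith [hr.2]
  have hgam : 0 < gam n s := by unfold gam; have := n.cast_nonneg (α := ℝ); linarith
  have hri : ∀ i : ℕ, 0 < r ^ i := fun i => pow_pos hr0 i
  set c : ℕ → ℝ := fun i => 4 ^ gam n s * 4 ^ (N + 1) * ((r ^ i) ^ (-gam n s) * wt N (R / r ^ i))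
  have hpt : ∀ p ∈ Q n 1, 0 < pnorm p →
      ‖g p‖ₑ * ENNReal.ofReal (pnorm p ^ (-gam n s) * wt N (R / pnorm p)) ≤
        ∑' i : ℕ, (Q n (r ^ i)).indicator (fun p => ENNReal.ofReal (c i) * ‖g p‖ₑ) p := by
    intro p hpQ hp
    have hp1 := (mem_Q_iff one_pos).1 hpQ
    obtain ⟨i, hi1, hi2⟩ : ∃ i : ℕ, r ^ (i + 1) ≤ pnorm p ∧ pnorm p < r ^ i := by
      obtain ⟨i, h1, h2⟩ := exists_nat_pow_near_of_lt_one hp hp1.1.le hr0 hr1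
      rcases h2.lt_or_eq with h2 | h2
      · exact ⟨i, h1.le, h2⟩
      · cases i with
        | zero => rw [pow_zero] at h2; exact absurd h2 hp1.1.ne
        | succ i =>
          exact ⟨i, h2.ge, h2.trans_lt (pow_lt_pow_right_of_lt_one₀ hr0 hr1 (Nat.lt_succ_self i))⟩
    refine le_trans ?_ (ENNReal.le_tsum i)
    rw [indicator_of_mem ((mem_Q_iff (hri i)).2 ⟨hi2, hp1.2⟩), mul_comm]
    refine mul_le_mul_left (ENNReal.ofReal_le_ofReal ?_) _
    -- `r ≥ 1/4`, so lengths within an annulus agree up to the factor `4`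
    have hq : r ^ i / 4 ≤ pnorm p := by
      rw [pow_succ] at hi1
      nlinarith [hri i, hr.1]
    have h1 : pnorm p ^ (-gam n s) ≤ 4 ^ gam n s * (r ^ i) ^ (-gam n s) := by
      rw [Real.rpow_neg hp.le, Real.rpow_neg (hri i).le, ← Real.inv_rpow hp.le,
        ← Real.inv_rpow (hri i).le, ← Real.mul_rpow (by norm_num) (by positivity)]
      refine Real.rpow_le_rpow (by positivity) ?_ hgam.le
      rw [inv_le_comm₀ hp (by have := hri i; positivity), mul_inv, inv_inv]
      linarith
    have h2 : wt N (R / pnorm p) ≤ 4 ^ (N + 1) * wt N (R / r ^ i) := by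
      refine (wt_mono N (by positivity) ?_).trans (wt_four_mul_le N (div_nonneg hR (hri i).le))
      rw [← mul_div_assoc, div_le_div_iff₀ hp (hri i)]
      nlinarith
    have h3 : 0 ≤ wt N (R / pnorm p) := wt_nonneg N (by positivity)
    calc _ ≤ (4 ^ gam n s * (r ^ i) ^ (-gam n s)) * (4 ^ (N + 1) * wt N (R / r ^ i)) :=
          mul_le_mul h1 h2 h3 (by have := hri i; positivity)
      _ = _ := by ring
  calc Phi s N g R ≤ ∫⁻ p in Q n 1, ∑' i : ℕ,
        (Q n (r ^ i)).indicator (fun p => ENNReal.ofReal (c i) * ‖g p‖ₑ) p := by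
        refine lintegral_mono_ae ?_
        filter_upwards [ae_restrict_mem (measurableSet_Q 1), ae_restrict_of_ae ae_pnorm_pos]
          with p h1 h2 using hpt p h1 h2
    _ = ∑' i : ℕ, ∫⁻ p in Q n 1,
        (Q n (r ^ i)).indicator (fun p => ENNReal.ofReal (c i) * ‖g p‖ₑ) p :=
        lintegral_tsum fun i => (hg.enorm.const_mul _).indicator (measurableSet_Q _)
    _ ≤ _ := by
        refine ENNReal.tsum_le_tsum fun i => ?_
        rw [lintegral_indicator (measurableSet_Q _), lintegral_const_mul' _ _ ENNReal.ofReal_ne_top]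
        exact mul_le_mul_right (lintegral_mono' (Measure.restrict_mono_measure
          Measure.restrict_le_self _) le_rfl) _

theorem setLIntegral_le_nu (f P : SpaceTime n → ℝ) {r : ℝ} (hr : 0 < r) :
    ∫⁻ p in Q n r, ‖f p - P p‖ₑ ≤ ENNReal.ofReal (ballVol n * r ^ (n + 2)) * nu f P r := by
  have hv := ballVol_pos (n := n)
  have h1 : meanOsc f P r ≤ nu f P r := le_iSup₂_of_le r ⟨hr, le_rfl⟩ le_rfl
  refine le_trans ?_ (mul_le_mul_right h1 _)
  have h0 : ENNReal.ofReal (ballVol n * r ^ (n + 2)) ≠ 0 := by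
    rw [Ne, ENNReal.ofReal_eq_zero, not_le]; positivity
  rw [meanOsc_eq _ _ hr, ENNReal.mul_div_cancel h0 ENNReal.ofReal_ne_top]

/-- The terms of the annular sum for `Phi` at scale `r^m` in terms of those of the series for `f`.
-/
theorem Phi_le_dsum {s : ℝ} (hs₁ : s < 1) (N k : ℕ) (α : ℝ) (h₁ : (N : ℝ) ≤ k + α + 2 * s)
    (h₂ : k + α + 2 * s ≤ N + 1) {f P : SpaceTime n → ℝ}
    (hg : AEStronglyMeasurable (fun z => f z - P z) (volume.restrict (Q n 1)))
    {r : ℝ} (hr : r ∈ Icc (1 / 4 : ℝ) (1 / 2)) (m : ℕ) :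
    Phi s N (fun z => f z - P z) (r ^ m) ≤
      ENNReal.ofReal (4 ^ gam n s * 4 ^ (N + 1) * ballVol n * (r ^ m) ^ (k + α + 2 * s)) *
        dsum (ENNReal.ofReal ((1 / 2) ^ (k + α + 2 * s - N)))
          (ENNReal.ofReal ((1 / 2) ^ (N + 1 - (k + α + 2 * s)))) (seriesTerm f P k α 1 r) m := by
  have hr0 : 0 < r := by linarith [hr.1]
  have hr1 : r ≤ 1 := by linarith [hr.2]
  have hv := ballVol_pos (n := n)
  have hri : ∀ i : ℕ, 0 < r ^ i := fun i => pow_pos hr0 i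
  set e := (k : ℝ) + α + 2 * s with he
  set A := (4 : ℝ) ^ gam n s * 4 ^ (N + 1) * ballVol n with hA
  have hA0 : 0 < A := by positivity
  have hterm : ∀ i : ℕ, ENNReal.ofReal (4 ^ gam n s * 4 ^ (N + 1) *
      ((r ^ i) ^ (-gam n s) * wt N (r ^ m / r ^ i))) * ∫⁻ p in Q n (r ^ i), ‖f p - P p‖ₑ ≤
      ENNReal.ofReal A * (ENNReal.ofReal ((r ^ i) ^ e * wt N (r ^ m / r ^ i)) *
        seriesTerm f P k α 1 r i) := by
    intro i
    have hw := wt_nonneg N (u := r ^ m / r ^ i) (by positivity)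
    have hpos := Real.rpow_pos_of_pos (hri i) e
    refine (mul_le_mul_right (setLIntegral_le_nu f P (hri i)) _).trans_eq ?_
    rw [seriesTerm, one_mul, ← mul_assoc, ← ENNReal.ofReal_mul (by positivity),
      ← mul_assoc (ENNReal.ofReal A), ← ENNReal.ofReal_mul hA0.le,
      ← mul_assoc (ENNReal.ofReal (A * _)), ← ENNReal.ofReal_mul (by positivity)]
    congr 2
    have h3 : (r ^ i) ^ (-gam n s) * (r ^ i) ^ (n + 2) =
        (r ^ i) ^ e * (r ^ i) ^ (-((k : ℝ) + α)) := by
      rw [← Real.rpow_natCast (r ^ i) (n + 2), ← Real.rpow_add (hri i), ← Real.rpow_add (hri i),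
        gam, he]
      congr 1
      push_cast; ring
    rw [hA]
    linear_combination (4 ^ gam n s * 4 ^ (N + 1) * wt N (r ^ m / r ^ i) * ballVol n) * h3
  refine (Phi_le_tsum hs₁ N hg hr (hri m).le).trans ((ENNReal.tsum_le_tsum hterm).trans ?_)
  rw [ENNReal.tsum_mul_left, ENNReal.ofReal_mul hA0.le, mul_assoc]
  refine mul_le_mul_right ?_ _
  rw [← ENNReal.summable.sum_add_tsum_nat_add' (k := m), dsum, mul_add, Finset.mul_sum,
    ← ENNReal.tsum_mul_left]
  refine add_le_add (Finset.sum_le_sum fun i hi => ?_) (ENNReal.tsum_le_tsum fun j => ?_)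
  · rw [← mul_assoc, ← ENNReal.ofReal_pow (by positivity), ← ENNReal.ofReal_mul (by positivity)]
    refine mul_le_mul_left (ENNReal.ofReal_le_ofReal ?_) _
    obtain ⟨d, rfl⟩ := Nat.exists_eq_add_of_lt (Finset.mem_range.1 hi)
    have h4 : r ^ (i + d + 1) / r ^ i = r ^ (d + 1) := by
      rw [add_assoc, pow_add, mul_div_cancel_left₀ _ (hri i).ne']
    have h5 : i + d + 1 - i = d + 1 := by omega
    have h6 : (r ^ i) ^ e * wt N (r ^ (d + 1)) =
        (r ^ (i + d + 1)) ^ e * (r ^ (N + 1 - e)) ^ (d + 1) := by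
      rw [wt, min_eq_right (pow_le_one₀ hr0.le hr1), ← pow_succ, add_assoc, pow_add r i,
        Real.mul_rpow (hri i).le (hri _).le, mul_assoc, ← Real.rpow_natCast (r ^ (N + 1 - e)),
        ← Real.rpow_natCast r (d + 1), ← Real.rpow_mul hr0.le, ← Real.rpow_mul hr0.le,
        ← Real.rpow_natCast (r ^ ((d + 1 : ℕ) : ℝ)), ← Real.rpow_mul hr0.le, ← Real.rpow_add hr0]
      congr 2
      push_cast; ring
    rw [h4, h5, h6]
    have h7 : r ^ (N + 1 - e) ≤ (1 / 2) ^ (N + 1 - e) :=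
      Real.rpow_le_rpow hr0.le hr.2 (by linarith)
    have := hri (i + d + 1)
    gcongr
  · rw [← mul_assoc, ← ENNReal.ofReal_pow (by positivity), ← ENNReal.ofReal_mul (by positivity)]
    refine mul_le_mul_left (ENNReal.ofReal_le_ofReal ?_) _
    have h4 : r ^ m / r ^ (j + m) = (r ^ j)⁻¹ := by
      rw [pow_add, div_mul_cancel_right₀ (hri m).ne']
    have h6 : (r ^ (j + m)) ^ e * wt N (r ^ j)⁻¹ = (r ^ m) ^ e * (r ^ (e - N)) ^ j := by
      rw [wt, min_eq_left ((one_le_inv₀ (hri j)).2 (pow_le_one₀ hr0.le hr1)), mul_one, pow_add,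
        Real.mul_rpow (hri j).le (hri m).le, mul_right_comm, mul_comm]
      congr 1
      rw [← Real.rpow_natCast (r ^ (e - N)), ← Real.rpow_natCast r j, ← Real.rpow_mul hr0.le,
        ← Real.rpow_mul hr0.le, ← Real.rpow_neg hr0.le, ← Real.rpow_natCast (r ^ (-(j : ℝ))),
        ← Real.rpow_mul hr0.le, ← Real.rpow_add hr0]
      congr 1
      ring
    rw [h4, h6]
    have h7 : r ^ (e - N) ≤ (1 / 2) ^ (e - N) := Real.rpow_le_rpow hr0.le hr.2 (by linarith)
    have := hri m
    gcongr

/-! ### Estimates in the pointwise spaces -/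

theorem integrableOn_parabolicPoly (k : ℕ) (a : (Fin n → ℕ) × ℕ → ℝ) :
    IntegrableOn (parabolicPoly k a) (Q n 1) :=
  ((continuous_parabolicPoly k a).locallyIntegrable.integrableOn_isCompact
    (isCompact_closedBall (0 : SpaceTime n) 1)).mono_set
    (Q_one_subset.trans (Qtilde_one.subset.trans Metric.ball_subset_closedBall))

theorem integrableOn_sub_of_nu {f : SpaceTime n → ℝ} {k : ℕ} {a : (Fin n → ℕ) × ℕ → ℝ}
    (hf : AEStronglyMeasurable f (volume.restrict (Q n 1)))
    (h : nu f (parabolicPoly k a) 1 ≠ ⊤) :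
    IntegrableOn (fun z => f z - parabolicPoly k a z) (Q n 1) :=
  ⟨hf.sub (continuous_parabolicPoly k a).aestronglyMeasurable,
    (setLIntegral_le_nu f _ one_pos).trans_lt
      (ENNReal.mul_lt_top ENNReal.ofReal_lt_top h.lt_top)⟩

theorem integrableOn_of_nu {f : SpaceTime n → ℝ} {k : ℕ} {a : (Fin n → ℕ) × ℕ → ℝ}
    (hf : AEStronglyMeasurable f (volume.restrict (Q n 1)))
    (h : nu f (parabolicPoly k a) 1 ≠ ⊤) : IntegrableOn f (Q n 1) := by
  have := (integrableOn_sub_of_nu hf h).add (integrableOn_parabolicPoly k a)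
  refine this.congr (Filter.Eventually.of_forall fun z => ?_)
  simp

theorem seriesTerm_zero (f P : SpaceTime n → ℝ) (k : ℕ) (α r : ℝ) :
    seriesTerm f P k α 1 r 0 = nu f P 1 := by
  simp [seriesTerm]

/-- The weighted sum of the terms of the series of `f` that controls the scale `r^m`. -/
def fsum (N : ℕ) (s : ℝ) (k : ℕ) (α : ℝ) (f : SpaceTime n → ℝ) (a : (Fin n → ℕ) × ℕ → ℝ) (r : ℝ)
    (m : ℕ) : ℝ≥0∞ :=
  dsum (ENNReal.ofReal ((1 / 2) ^ (k + α + 2 * s - N)))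
    (ENNReal.ofReal ((1 / 2) ^ (N + 1 - (k + α + 2 * s))))
    (seriesTerm f (parabolicPoly k a) k α 1 r) m

/-- The main estimate: `w₁` deviates from a polynomial of degree at most `N` by the weighted sum of
the terms of the series of `f`, for any `N` with `N ≤ k + α + 2s ≤ N + 1`. -/
theorem exists_meanOsc_bound (n k : ℕ) (α : ℝ) {s : ℝ} (hs : 0 < s) (hs₁ : s < 1) (N : ℕ)
    (h₁ : (N : ℝ) ≤ k + α + 2 * s) (h₂ : k + α + 2 * s ≤ N + 1) :
    ∃ C : ℝ, 0 ≤ C ∧ ∀ (f : SpaceTime n → ℝ) (a : (Fin n → ℕ) × ℕ → ℝ),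
      AEStronglyMeasurable f (volume.restrict (Q n 1)) →
      fsum N s k α f a (1 / 2) 0 ≠ ⊤ →
      ∃ b : (Fin n → ℕ) × ℕ → ℝ, (∀ σ ∉ multiIndices n N, b σ = 0) ∧
        polyNorm N b ≤ C * ((fsum N s k α f a (1 / 2) 0).toReal + polyNorm k a) ∧
        ∀ r ∈ Icc (1 / 4 : ℝ) (1 / 2), ∀ (m : ℕ) (R : ℝ), 0 < R → R ≤ 1 / 2 → R ≤ r ^ m →
          meanOsc (w₁ s f) (parabolicPoly N b) R ≤
            ENNReal.ofReal (C * (r ^ m) ^ (k + α + 2 * s)) *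
              (fsum N s k α f a r m + ENNReal.ofReal (polyNorm k a)) := by
  obtain ⟨D, hD0, hD⟩ := exists_w₁_approx n k hs hs₁ N
  set e := (k : ℝ) + α + 2 * s with he
  have hv := ballVol_pos (n := n)
  set A := (4 : ℝ) ^ gam n s * 4 ^ (N + 1) * ballVol n with hA
  have hA0 : 0 < A := by positivity
  refine ⟨D * (A + 1), by positivity, fun f a hf hS => ?_⟩
  have hnu : nu f (parabolicPoly k a) 1 ≠ ⊤ := by
    rw [← seriesTerm_zero f (parabolicPoly k a) k α (1 / 2)]
    exact ((le_dsum_zero _ _ _).trans_lt hS.lt_top).ne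
  have hg := integrableOn_sub_of_nu hf hnu
  have hPhi := fun r (hr : r ∈ Icc (1 / 4 : ℝ) (1 / 2)) m =>
    Phi_le_dsum hs₁ N k α h₁ h₂ hg.aestronglyMeasurable hr m
  have hP0 := polyNorm_nonneg k a
  have hPhi1 : Phi s N (fun z => f z - parabolicPoly k a z) 1 ≤
      ENNReal.ofReal A * fsum N s k α f a (1 / 2) 0 := by
    have := hPhi (1 / 2) (by norm_num) 0
    rwa [pow_zero, Real.one_rpow, mul_one] at this
  have hPhi1t : Phi s N (fun z => f z - parabolicPoly k a z) 1 ≠ ⊤ :=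
    (hPhi1.trans_lt (ENNReal.mul_lt_top ENNReal.ofReal_lt_top hS.lt_top)).ne
  obtain ⟨b, hb0, hb, hbr⟩ := hD f a hg hPhi1t
  refine ⟨b, hb0, hb.trans ?_, fun r hr m R hR0 hR hRr => (hbr R hR0 hR).trans ?_⟩
  · have h3 := ENNReal.toReal_mono (ENNReal.mul_ne_top ENNReal.ofReal_ne_top hS) hPhi1
    rw [ENNReal.toReal_mul, ENNReal.toReal_ofReal hA0.le] at h3
    have h4 : 0 ≤ (fsum N s k α f a (1 / 2) 0).toReal := ENNReal.toReal_nonneg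
    rw [mul_assoc]
    refine mul_le_mul_of_nonneg_left ?_ hD0
    nlinarith [mul_nonneg hA0.le hP0]
  · have hr0 : 0 < r := by linarith [hr.1]
    have hr1 : r ≤ 1 := by linarith [hr.2]
    have hrm : 0 < r ^ m := pow_pos hr0 m
    have h3 : R ^ (N + 1) ≤ (r ^ m) ^ e := by
      refine (pow_le_pow_left₀ hR0.le hRr _).trans ?_
      rw [← Real.rpow_natCast (r ^ m)]
      refine Real.rpow_le_rpow_of_exponent_ge hrm (pow_le_one₀ hr0.le hr1) ?_
      push_cast
      exact h₂
    have h4 : Phi s N (fun z => f z - parabolicPoly k a z) R ≤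
        ENNReal.ofReal (A * (r ^ m) ^ e) * fsum N s k α f a r m :=
      (Phi_mono s N _ hR0.le hRr).trans (hPhi r hr m)
    have h5 : 0 < (r ^ m) ^ e := Real.rpow_pos_of_pos hrm e
    calc _ ≤ ENNReal.ofReal D * (ENNReal.ofReal (A * (r ^ m) ^ e) * fsum N s k α f a r m +
          ENNReal.ofReal ((r ^ m) ^ e) * ENNReal.ofReal (polyNorm k a)) := by
          rw [← ENNReal.ofReal_mul h5.le, mul_comm _ (polyNorm k a)]
          gcongr
      _ ≤ ENNReal.ofReal D * (ENNReal.ofReal ((A + 1) * (r ^ m) ^ e) * fsum N s k α f a r m +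
          ENNReal.ofReal ((A + 1) * (r ^ m) ^ e) * ENNReal.ofReal (polyNorm k a)) := by
          gcongr
          · linarith
          · nlinarith
      _ = _ := by
          rw [← mul_add, ← mul_assoc, ← ENNReal.ofReal_mul hD0, mul_assoc]

/-- A bound of the mean oscillation that is uniform in the radii below a dyadic scale is a bound of
the term of the series at that scale. -/
theorem seriesTerm_le_of_meanOsc {w P : SpaceTime n → ℝ} {C e : ℝ} {S : ℝ≥0∞}
    {r : ℝ} (hr : r ∈ Icc (1 / 4 : ℝ) (1 / 2)) {m : ℕ}
    (h : ∀ R : ℝ, 0 < R → R ≤ 1 / 2 → R ≤ r ^ m →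
      meanOsc w P R ≤ ENNReal.ofReal (C * (r ^ m) ^ e) * S) {M : ℕ} {β : ℝ} (he : (M : ℝ) + β = e) :
    seriesTerm w P M β (1 / 2) r m ≤ ENNReal.ofReal (C * 2 ^ e) * S := by
  have hr0 : 0 < r := by linarith [hr.1]
  have hrm : 0 < r ^ m := pow_pos hr0 m
  have hrm1 : r ^ m ≤ 1 := pow_le_one₀ hr0.le (by linarith [hr.2])
  have h1 : nu w P (1 / 2 * r ^ m) ≤ ENNReal.ofReal (C * (r ^ m) ^ e) * S :=
    iSup₂_le fun R hR => h R hR.1 (by linarith [hR.2]) (by linarith [hR.2])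
  have h2 : (1 / 2 * r ^ m) ^ (-e) * (r ^ m) ^ e = 2 ^ e := by
    rw [Real.mul_rpow (by norm_num) hrm.le, mul_assoc, ← Real.rpow_add hrm, neg_add_cancel,
      Real.rpow_zero, mul_one, one_div, Real.inv_rpow zero_le_two, Real.rpow_neg zero_le_two,
      inv_inv]
  rw [seriesTerm, he]
  calc _ ≤ ENNReal.ofReal ((1 / 2 * r ^ m) ^ (-e)) * (ENNReal.ofReal (C * (r ^ m) ^ e) * S) := by
        gcongr
    _ = _ := by
        rw [← mul_assoc, ← ENNReal.ofReal_mul (by positivity), mul_left_comm, h2]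

theorem infNorm_nonneg {A : (SpaceTime n → ℝ) → ℝ → ((Fin n → ℕ) × ℕ → ℝ) → Prop} {k : ℕ}
    {f : SpaceTime n → ℝ} (hA : ∀ K a, A f K a → 0 ≤ K) : 0 ≤ infNorm A k f := by
  refine Real.sInf_nonneg ?_
  rintro _ ⟨K, a, hKa, rfl⟩
  exact add_nonneg (hA _ _ hKa) (polyNorm_nonneg _ _)

/-- Membership and norm bound for `w₁` from a bound of its admissible pairs. -/
theorem mem_and_infNorm_le {A B : (SpaceTime n → ℝ) → ℝ → ((Fin n → ℕ) × ℕ → ℝ) → Prop}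
    {k M : ℕ} {s : ℝ} (hs : 0 < s) {f : SpaceTime n → ℝ} {C : ℝ} (hC : 0 < C)
    (hB : ∀ w K b, B w K b → 0 ≤ K) (hf : Mem A 1 f) (hfi : IntegrableOn f (Q n 1))
    (h : ∀ K a, A f K a → ∃ K' b, B (w₁ s f) K' b ∧
      K' + polyNorm M b ≤ C * (K + polyNorm k a)) :
    Mem B (1 / 2) (w₁ s f) ∧ infNorm B M (w₁ s f) ≤ C * infNorm A k f := by
  obtain ⟨-, K, a, hKa⟩ := hf
  obtain ⟨K', b, hb, -⟩ := h K a hKa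
  refine ⟨⟨aestronglyMeasurable_w₁ hs hfi _, K', b, hb⟩, ?_⟩
  rw [← div_le_iff₀' hC]
  refine le_csInf ⟨_, K, a, hKa, rfl⟩ ?_
  rintro _ ⟨K, a, hKa, rfl⟩
  obtain ⟨K', b, hb, hle⟩ := h K a hKa
  rw [div_le_iff₀' hC]
  have hbdd : BddBelow {c | ∃ K a, B (w₁ s f) K a ∧ c = K + polyNorm M a} := by
    refine ⟨0, ?_⟩
    rintro _ ⟨K, a, hKa, rfl⟩
    exact add_nonneg (hB _ _ _ hKa) (polyNorm_nonneg _ _)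
  exact (csInf_le hbdd ⟨K', b, hb, rfl⟩).trans hle

theorem Adm.sum_le {k : ℕ} {α r₀ : ℝ} {f : SpaceTime n → ℝ} {K : ℝ} {a : (Fin n → ℕ) × ℕ → ℝ}
    (h : Adm k α r₀ f K a) {r : ℝ} (hr : r ∈ Icc (1 / 4 : ℝ) (1 / 2)) (m : ℕ) (hm : 1 ≤ m) :
    ∑ i ∈ Finset.range m, seriesTerm f (parabolicPoly k a) k α r₀ r i ≤ ENNReal.ofReal K * m := by
  have := h.2 r hr m hm
  rwa [ENNReal.ofReal_mul h.1, ENNReal.ofReal_natCast] at this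

theorem MemC.integrableOn {k : ℕ} {α : ℝ} {f : SpaceTime n → ℝ} (hf : MemC k α 1 f) :
    IntegrableOn f (Q n 1) := by
  obtain ⟨hm, K, a, h⟩ := hf
  refine integrableOn_of_nu (k := k) (a := a) hm ?_
  have := h.sum_le (r := 1 / 2) (by norm_num) 1 le_rfl
  rw [Finset.sum_range_one, seriesTerm_zero, Nat.cast_one, mul_one] at this
  exact (this.trans_lt ENNReal.ofReal_lt_top).ne

theorem MemCDini.integrableOn {k : ℕ} {α : ℝ} {f : SpaceTime n → ℝ} (hf : MemCDini k α 1 f) :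
    IntegrableOn f (Q n 1) := by
  obtain ⟨hm, K, a, h⟩ := hf
  refine integrableOn_of_nu (k := k) (a := a) hm ?_
  have := (ENNReal.le_tsum 0).trans (h.2 (1 / 2) (by norm_num))
  rw [seriesTerm_zero] at this
  exact (this.trans_lt ENNReal.ofReal_lt_top).ne

theorem half_rpow_lt_one {x : ℝ} (hx : 0 < x) : (1 / 2 : ℝ) ^ x < 1 :=
  Real.rpow_lt_one (by norm_num) (by norm_num) hx

theorem ofReal_half_rpow_le_one {x : ℝ} (hx : 0 ≤ x) : ENNReal.ofReal ((1 / 2 : ℝ) ^ x) ≤ 1 :=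
  ENNReal.ofReal_le_one.2 (Real.rpow_le_one (by norm_num) (by norm_num) hx)

/-- A non-integer exponent: both ratios of the weighted sum are less than one. -/
theorem exists_normC_le (n k : ℕ) (α : ℝ) {s : ℝ} (hs : 0 < s) (hs₁ : s < 1) (N : ℕ) (β : ℝ)
    (he : (N : ℝ) + β = k + α + 2 * s) (h₁ : 0 < β) (h₂ : β < 1) :
    ∃ C : ℝ, 0 < C ∧ ∀ f : SpaceTime n → ℝ, MemC k α 1 f →
      MemC N β (1 / 2) (w₁ s f) ∧ normC N β (1 / 2) (w₁ s f) ≤ C * normC k α 1 f := by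
  obtain ⟨C, hC0, hC⟩ := exists_meanOsc_bound n k α hs hs₁ N (by linarith) (by linarith)
  set e := (k : ℝ) + α + 2 * s
  obtain ⟨W₁, hW₁⟩ : ∃ W₁, W₁ = wgeom (ENNReal.ofReal ((1 / 2) ^ (e - N))) := ⟨_, rfl⟩
  obtain ⟨W₂, hW₂⟩ : ∃ W₂, W₂ = wgeom (ENNReal.ofReal ((1 / 2) ^ (N + 1 - e))) := ⟨_, rfl⟩
  have hW₁t : W₁ ≠ ⊤ := hW₁ ▸ wgeom_ne_top (by positivity) (half_rpow_lt_one (by linarith))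
  have hW₂t : W₂ ≠ ⊤ := hW₂ ▸ wgeom_ne_top (by positivity) (half_rpow_lt_one (by linarith))
  have hq₂ := ofReal_half_rpow_le_one (show 0 ≤ N + 1 - e by linarith)
  set L := (W₂ + W₁).toReal with hL
  have hL0 : 0 ≤ L := ENNReal.toReal_nonneg
  set L' := (1 + W₁).toReal with hL'
  have hL'0 : 0 ≤ L' := ENNReal.toReal_nonneg
  have hLe : W₂ + W₁ = ENNReal.ofReal L :=
    (ENNReal.ofReal_toReal (ENNReal.add_ne_top.2 ⟨hW₂t, hW₁t⟩)).symm
  have hL'e : 1 + W₁ = ENNReal.ofReal L' :=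
    (ENNReal.ofReal_toReal (ENNReal.add_ne_top.2 ⟨ENNReal.one_ne_top, hW₁t⟩)).symm
  refine ⟨C * 2 ^ e * (L + 1) + C * (L' + 1) + 1, by positivity, fun f hf =>
    mem_and_infNorm_le hs (by positivity) (fun _ _ _ h => h.1) hf hf.integrableOn
      fun K a hKa => ?_⟩
  have hK0 := hKa.1
  have hP0 := polyNorm_nonneg k a
  have hS0 : fsum N s k α f a (1 / 2) 0 ≤ ENNReal.ofReal (K * L') := by
    have := dsum_le (q₁ := ENNReal.ofReal ((1 / 2) ^ (e - N))) hq₂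
      (hKa.sum_le (r := 1 / 2) (by norm_num)) 0
    rwa [← hW₁, hL'e, Nat.cast_zero, zero_add, mul_one, ← ENNReal.ofReal_mul hK0] at this
  obtain ⟨b, hb0, hb, hbr⟩ := hC f a hf.1 (hS0.trans_lt ENNReal.ofReal_lt_top).ne
  refine ⟨C * 2 ^ e * (K * L + polyNorm k a), b, ⟨by positivity, fun r hr M hM => ?_⟩, ?_⟩
  · have hsum : ∑ m ∈ Finset.range M, fsum N s k α f a r m ≤ ENNReal.ofReal (K * L) * M := by
      have := sum_dsum_le (q₁ := ENNReal.ofReal ((1 / 2) ^ (e - N))) hq₂ (hKa.sum_le hr) hM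
      rwa [← hW₁, ← hW₂, hLe, ← ENNReal.ofReal_mul hK0] at this
    calc _ ≤ ∑ m ∈ Finset.range M, ENNReal.ofReal (C * 2 ^ e) *
          (fsum N s k α f a r m + ENNReal.ofReal (polyNorm k a)) :=
          Finset.sum_le_sum fun m _ => seriesTerm_le_of_meanOsc hr (hbr r hr m) he
      _ = ENNReal.ofReal (C * 2 ^ e) * (∑ m ∈ Finset.range M, fsum N s k α f a r m +
          M * ENNReal.ofReal (polyNorm k a)) := by
          rw [← Finset.mul_sum, Finset.sum_add_distrib, Finset.sum_const, Finset.card_range,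
            nsmul_eq_mul]
      _ ≤ ENNReal.ofReal (C * 2 ^ e) * (ENNReal.ofReal (K * L) * M +
          M * ENNReal.ofReal (polyNorm k a)) := by gcongr
      _ = _ := by
          rw [mul_comm (M : ℝ≥0∞), ← add_mul, ← ENNReal.ofReal_add (by positivity) hP0, ← mul_assoc,
            ← ENNReal.ofReal_mul (by positivity), ENNReal.ofReal_mul (by positivity) (q := (M : ℝ)),
            ENNReal.ofReal_natCast]
  · have h3 : (fsum N s k α f a (1 / 2) 0).toReal ≤ K * L' :=
      ENNReal.toReal_le_of_le_ofReal (by positivity) hS0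
    have h4 : polyNorm N b ≤ C * (K * L' + polyNorm k a) := hb.trans (by gcongr)
    have h5 : 0 ≤ C * 2 ^ e := by positivity
    nlinarith [mul_nonneg h5 hK0, mul_nonneg h5 (mul_nonneg hL0 hP0), mul_nonneg hC0 hK0,
      mul_nonneg hC0 (mul_nonneg hL'0 hP0)]

/-- Under the Dini condition the weighted sums are bounded by the whole series. -/
theorem exists_normCDini_le (n k : ℕ) (α : ℝ) {s : ℝ} (hs : 0 < s) (hs₁ : s < 1) (N : ℕ) (β : ℝ)
    (he : (N : ℝ) + β = k + α + 2 * s) (h₁ : 0 ≤ β) (h₂ : β < 1) :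
    ∃ C : ℝ, 0 < C ∧ ∀ f : SpaceTime n → ℝ, MemCDini k α 1 f →
      MemC N β (1 / 2) (w₁ s f) ∧ normC N β (1 / 2) (w₁ s f) ≤ C * normCDini k α 1 f := by
  obtain ⟨C, hC0, hC⟩ := exists_meanOsc_bound n k α hs hs₁ N (by linarith) (by linarith)
  set e := (k : ℝ) + α + 2 * s
  refine ⟨C * 2 ^ e + C + 1, by positivity, fun f hf =>
    mem_and_infNorm_le hs (by positivity) (fun _ _ _ h => h.1) hf hf.integrableOn
      fun K a hKa => ?_⟩
  have hK0 := hKa.1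
  have hP0 := polyNorm_nonneg k a
  have hS : ∀ r ∈ Icc (1 / 4 : ℝ) (1 / 2), ∀ m, fsum N s k α f a r m ≤ ENNReal.ofReal K :=
    fun r hr m => (dsum_le_tsum (ofReal_half_rpow_le_one (by linarith))
      (ofReal_half_rpow_le_one (by linarith)) _ m).trans (hKa.2 r hr)
  have hS0 := hS (1 / 2) (by norm_num) 0
  obtain ⟨b, hb0, hb, hbr⟩ := hC f a hf.1 (hS0.trans_lt ENNReal.ofReal_lt_top).ne
  refine ⟨C * 2 ^ e * (K + polyNorm k a), b, ⟨by positivity, fun r hr M hM => ?_⟩, ?_⟩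
  · calc _ ≤ ∑ m ∈ Finset.range M, ENNReal.ofReal (C * 2 ^ e * (K + polyNorm k a)) := by
          refine Finset.sum_le_sum fun m _ =>
            (seriesTerm_le_of_meanOsc hr (hbr r hr m) he).trans ?_
          rw [ENNReal.ofReal_mul (by positivity) (q := K + _), ENNReal.ofReal_add hK0 hP0]
          gcongr
          exact hS r hr m
      _ = _ := by
          rw [Finset.sum_const, Finset.card_range, nsmul_eq_mul, mul_comm,
            ENNReal.ofReal_mul (by positivity) (q := (M : ℝ)), ENNReal.ofReal_natCast]
  · have h3 := ENNReal.toReal_le_of_le_ofReal hK0 hS0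
    have h4 : polyNorm N b ≤ C * (K + polyNorm k a) := hb.trans (by gcongr)
    linarith

/-- The integer exponent `N + 1`: with Taylor polynomials of degree `N` only, the weighted sums grow
at most linearly. -/
theorem exists_bound_of_integer (n k : ℕ) (α : ℝ) {s : ℝ} (hs : 0 < s) (hs₁ : s < 1) (N : ℕ)
    (he : (k : ℝ) + α + 2 * s = N + 1) :
    ∃ C : ℝ, 0 ≤ C ∧ ∀ (f : SpaceTime n → ℝ) (K : ℝ) (a : (Fin n → ℕ) × ℕ → ℝ), MemC k α 1 f →
      Adm k α 1 f K a → ∃ b : (Fin n → ℕ) × ℕ → ℝ,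
        polyNorm (N + 1) b ≤ C * (K + polyNorm k a) ∧
        ∀ r ∈ Icc (1 / 4 : ℝ) (1 / 2), ∀ (m : ℕ) (R : ℝ), 0 < R → R ≤ 1 / 2 → R ≤ r ^ m →
          meanOsc (w₁ s f) (parabolicPoly (N + 1) b) R ≤
            ENNReal.ofReal (C * (r ^ m) ^ ((N : ℝ) + 1)) *
              ENNReal.ofReal ((K + polyNorm k a) * (m + 1)) := by
  obtain ⟨C, hC0, hC⟩ := exists_meanOsc_bound n k α hs hs₁ N (by linarith) (by linarith)
  rw [he] at hC
  obtain ⟨W, hW⟩ : ∃ W, W = wgeom (ENNReal.ofReal ((1 / 2) ^ ((N : ℝ) + 1 - N))) := ⟨_, rfl⟩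
  have hWt : W ≠ ⊤ := hW ▸ wgeom_ne_top (by positivity) (half_rpow_lt_one (by linarith))
  have hq₂ := ofReal_half_rpow_le_one (show 0 ≤ (N : ℝ) + 1 - (N + 1) by linarith)
  set L := (1 + W).toReal with hL
  have hL0 : 0 ≤ L := ENNReal.toReal_nonneg
  have hLe : 1 + W = ENNReal.ofReal L :=
    (ENNReal.ofReal_toReal (ENNReal.add_ne_top.2 ⟨ENNReal.one_ne_top, hWt⟩)).symm
  refine ⟨C * (L + 1), by positivity, fun f K a hf hKa => ?_⟩
  have hK0 := hKa.1
  have hP0 := polyNorm_nonneg k a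
  have hS : ∀ r ∈ Icc (1 / 4 : ℝ) (1 / 2), ∀ m : ℕ,
      fsum N s k α f a r m ≤ ENNReal.ofReal (K * L * (m + 1)) := by
    intro r hr m
    have := dsum_le (q₁ := ENNReal.ofReal ((1 / 2) ^ ((N : ℝ) + 1 - N))) hq₂ (hKa.sum_le hr) m
    rw [← hW, hLe, ← ENNReal.ofReal_mul hK0, ← ENNReal.ofReal_natCast, ← ENNReal.ofReal_one,
      ← ENNReal.ofReal_add (by positivity) zero_le_one, ← ENNReal.ofReal_mul (by positivity)]
      at this
    rwa [fsum, he]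
  have hS0 := hS (1 / 2) (by norm_num) 0
  obtain ⟨b, hb0, hb, hbr⟩ := hC f a hf.1 (hS0.trans_lt ENNReal.ofReal_lt_top).ne
  refine ⟨b, ?_, fun r hr m R hR0 hR hRr => ?_⟩
  · rw [polyNorm_eq_of_le (Nat.le_succ N) hb0]
    have h3 := ENNReal.toReal_le_of_le_ofReal (by positivity) hS0
    rw [Nat.cast_zero, zero_add, mul_one] at h3
    rw [mul_assoc]
    refine hb.trans (mul_le_mul_of_nonneg_left ?_ hC0)
    nlinarith [mul_nonneg hL0 hP0]
  · rw [parabolicPoly_eq_of_le (Nat.le_succ N) hb0]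
    have hr0 : 0 < r := by linarith [hr.1]
    refine (hbr r hr m R hR0 hR hRr).trans ?_
    calc _ ≤ ENNReal.ofReal (C * (r ^ m) ^ ((N : ℝ) + 1)) *
          (ENNReal.ofReal (K * L * (m + 1)) + ENNReal.ofReal (polyNorm k a)) := by
          gcongr
          exact hS r hr m
      _ ≤ _ := by
          rw [← ENNReal.ofReal_add (by positivity) hP0, ← ENNReal.ofReal_mul (by positivity),
            ← ENNReal.ofReal_mul (by positivity)]
          refine ENNReal.ofReal_le_ofReal ?_
          have h4 : K * L * (m + 1) + polyNorm k a ≤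
              (L + 1) * ((K + polyNorm k a) * ((m : ℝ) + 1)) := by
            have hm : (0 : ℝ) ≤ m := m.cast_nonneg
            have : (L + 1) * ((K + polyNorm k a) * ((m : ℝ) + 1)) -
                (K * L * (m + 1) + polyNorm k a) = K * (m + 1) +
                  polyNorm k a * (L * (m + 1) + m) := by ring
            have : 0 ≤ K * (m + 1) + polyNorm k a * (L * (m + 1) + m) := by positivity
            linarith
          have h5 : 0 ≤ C * (r ^ m) ^ ((N : ℝ) + 1) := by positivity
          calc _ ≤ C * (r ^ m) ^ ((N : ℝ) + 1) *
                ((L + 1) * ((K + polyNorm k a) * ((m : ℝ) + 1))) :=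
                mul_le_mul_of_nonneg_left h4 h5
            _ = _ := by ring

/-- Summing the linear growth of `exists_bound_of_integer` over the scales gives the quadratic
bound. -/
theorem exists_normCLn_le (n k : ℕ) (α : ℝ) {s : ℝ} (hs : 0 < s) (hs₁ : s < 1) (N : ℕ)
    (he : (k : ℝ) + α + 2 * s = N + 1) :
    ∃ C : ℝ, 0 < C ∧ ∀ f : SpaceTime n → ℝ, MemC k α 1 f →
      MemCLn (N + 1) 0 (1 / 2) (w₁ s f) ∧
        normCLn (N + 1) 0 (1 / 2) (w₁ s f) ≤ C * normC k α 1 f := by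
  obtain ⟨C, hC0, hC⟩ := exists_bound_of_integer n k α hs hs₁ N he
  refine ⟨C * 2 ^ ((N : ℝ) + 1) + C + 1, by positivity, fun f hf =>
    mem_and_infNorm_le hs (by positivity) (fun _ _ _ h => h.1) hf hf.integrableOn
      fun K a hKa => ?_⟩
  have hK0 := hKa.1
  have hP0 := polyNorm_nonneg k a
  obtain ⟨b, hb, hbr⟩ := hC f K a hf hKa
  refine ⟨C * 2 ^ ((N : ℝ) + 1) * (K + polyNorm k a), b, ⟨by positivity, fun r hr M hM => ?_⟩, ?_⟩
  · calc _ ≤ ∑ m ∈ Finset.range M,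
          ENNReal.ofReal (C * 2 ^ ((N : ℝ) + 1) * (K + polyNorm k a) * M) := by
          refine Finset.sum_le_sum fun m hm =>
            (seriesTerm_le_of_meanOsc hr (hbr r hr m) (by push_cast; ring)).trans ?_
          have h3 : (m : ℝ) + 1 ≤ M := by exact_mod_cast Finset.mem_range.1 hm
          rw [← ENNReal.ofReal_mul (by positivity), mul_assoc (C * _)]
          gcongr
      _ = _ := by
          rw [Finset.sum_const, Finset.card_range, nsmul_eq_mul, ← ENNReal.ofReal_natCast,
            ← ENNReal.ofReal_mul (by positivity)]
          congr 1
          ring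
  · linarith

/-- The linear growth of `exists_bound_of_integer` is logarithmic in the scale `R ≥ ‖x‖`. -/
theorem exists_normCXLn_le (n k : ℕ) (α : ℝ) {s : ℝ} (hs : 0 < s) (hs₁ : s < 1) (N : ℕ)
    (he : (k : ℝ) + α + 2 * s = N + 1) :
    ∃ C : ℝ, 0 < C ∧ ∀ f : SpaceTime n → ℝ, MemC k α 1 f →
      MemCXLn (N + 1) (1 / 2) (w₁ s f) ∧
        normCXLn (N + 1) (1 / 2) (w₁ s f) ≤ C * normC k α 1 f := by
  obtain ⟨C, hC0, hC⟩ := exists_bound_of_integer n k α hs hs₁ N he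
  refine ⟨C * 2 ^ (N + 1) * 3 + C + 1, by positivity, fun f hf =>
    mem_and_infNorm_le hs (by positivity) (fun _ _ _ h => h.1) hf hf.integrableOn
      fun K a hKa => ?_⟩
  have hK0 := hKa.1
  have hP0 := polyNorm_nonneg k a
  obtain ⟨b, hb, hbr⟩ := hC f K a hf hKa
  refine ⟨C * 2 ^ (N + 1) * 3 * (K + polyNorm k a), b, ⟨by positivity, fun z _ hz0 hzr => ?_⟩, ?_⟩
  · set R := √(‖z.1‖ ^ 2 + |z.2|) with hR
    have hx : 0 < ‖z.1‖ := norm_pos_iff.2 hz0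
    have hxR : ‖z.1‖ ≤ R := Real.le_sqrt_of_sq_le (le_add_of_nonneg_right (abs_nonneg _))
    have hR0 : 0 < R := hx.trans_le hxR
    obtain ⟨m, hm1, hm2⟩ := exists_nat_pow_near_of_lt_one hR0 (by linarith)
      (show (0 : ℝ) < 1 / 2 by norm_num) (by norm_num)
    -- `m` is at most logarithmic in the scale
    have hm3 : (m : ℝ) + 1 ≤ 3 * max 1 |Real.log ‖z.1‖| := by
      have h3 : Real.log ‖z.1‖ ≤ Real.log ((1 / 2) ^ m) :=
        Real.log_le_log hx (hxR.trans hm2)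
      rw [Real.log_pow, one_div, Real.log_inv] at h3
      have h4 : 1 / 2 < Real.log 2 := by linarith [Real.log_two_gt_d9]
      have h5 := neg_le_abs (Real.log ‖z.1‖)
      have h6 := le_max_left 1 |Real.log ‖z.1‖|
      have h7 := le_max_right 1 |Real.log ‖z.1‖|
      have hm0 : (0 : ℝ) ≤ m := m.cast_nonneg
      nlinarith
    have hm4 : ((1 / 2 : ℝ) ^ m) ^ ((N : ℝ) + 1) ≤ 2 ^ (N + 1) * R ^ (N + 1) := by
      rw [← mul_pow, ← Nat.cast_succ, Real.rpow_natCast]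
      refine pow_le_pow_left₀ (by positivity) ?_ _
      rw [pow_succ] at hm1
      linarith
    refine (hbr (1 / 2) (by norm_num) m R hR0 hzr hm2).trans ?_
    rw [← ENNReal.ofReal_mul (by positivity)]
    refine ENNReal.ofReal_le_ofReal ?_
    calc _ ≤ C * (2 ^ (N + 1) * R ^ (N + 1)) *
          ((K + polyNorm k a) * (3 * max 1 |Real.log ‖z.1‖|)) := by gcongr
      _ = _ := by ring
  · linarith

end FracHeat

end

theorem mainTheorem2 (n k : ℕ) (hn : 1 ≤ n) (α s : ℝ) (hα₀ : 0 ≤ α) (hα₁ : α < 1)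
    (hs₀ : 0 < s) (hs₁ : s < 1) :
    ∃ C : ℝ, 0 < C ∧ ∀ f : FracHeat.SpaceTime n → ℝ, (∀ z, 0 ≤ f z) →
      (FracHeat.MemC k α 1 f →
        (∀ᵐ z ∂(volume.restrict (FracHeat.Q n (1 / 2))),
          IntegrableOn (FracHeat.integrand s f z) (univ ×ˢ Iio z.2) volume) ∧
        ((∀ j : ℤ, 2 * s + α ≠ j) →
          FracHeat.MemC (k + ⌊α + 2 * s⌋₊) (Int.fract (α + 2 * s)) (1 / 2) (FracHeat.w₁ s f) ∧
          FracHeat.normC (k + ⌊α + 2 * s⌋₊) (Int.fract (α + 2 * s)) (1 / 2) (FracHeat.w₁ s f) ≤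
            C * FracHeat.normC k α 1 f) ∧
        (∀ N : ℕ, (k : ℝ) + α + 2 * s = N → Odd N →
          FracHeat.MemCXLn N (1 / 2) (FracHeat.w₁ s f) ∧
          FracHeat.normCXLn N (1 / 2) (FracHeat.w₁ s f) ≤ C * FracHeat.normC k α 1 f) ∧
        (∀ N : ℕ, (k : ℝ) + α + 2 * s = N → Even N →
          FracHeat.MemCLn N 0 (1 / 2) (FracHeat.w₁ s f) ∧
          FracHeat.normCLn N 0 (1 / 2) (FracHeat.w₁ s f) ≤ C * FracHeat.normC k α 1 f)) ∧
      (FracHeat.MemCDini k α 1 f →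
        FracHeat.MemC (k + ⌊α + 2 * s⌋₊) (Int.fract (α + 2 * s)) (1 / 2) (FracHeat.w₁ s f) ∧
        FracHeat.normC (k + ⌊α + 2 * s⌋₊) (Int.fract (α + 2 * s)) (1 / 2) (FracHeat.w₁ s f) ≤
          C * FracHeat.normCDini k α 1 f) := by
  set e := (k : ℝ) + α + 2 * s with he
  have hx0 : 0 ≤ α + 2 * s := by positivity
  have hfloor : ((k + ⌊α + 2 * s⌋₊ : ℕ) : ℝ) + Int.fract (α + 2 * s) = e := by
    rw [Nat.cast_add, natCast_floor_eq_intCast_floor hx0, he]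
    linarith [Int.floor_add_fract (α + 2 * s)]
  obtain ⟨C₁, hC₁, h₁⟩ : ∃ C : ℝ, 0 < C ∧ ((∀ j : ℤ, 2 * s + α ≠ j) →
      ∀ f : FracHeat.SpaceTime n → ℝ, FracHeat.MemC k α 1 f →
        FracHeat.MemC (k + ⌊α + 2 * s⌋₊) (Int.fract (α + 2 * s)) (1 / 2) (FracHeat.w₁ s f) ∧
          FracHeat.normC (k + ⌊α + 2 * s⌋₊) (Int.fract (α + 2 * s)) (1 / 2) (FracHeat.w₁ s f) ≤
            C * FracHeat.normC k α 1 f) := by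
    by_cases hint : ∀ j : ℤ, 2 * s + α ≠ j
    · have hpos : 0 < Int.fract (α + 2 * s) := by
        refine (Int.fract_nonneg _).lt_of_ne fun h => hint ⌊α + 2 * s⌋ ?_
        linarith [Int.floor_add_fract (α + 2 * s)]
      obtain ⟨C, hC, h⟩ := FracHeat.exists_normC_le n k α hs₀ hs₁ _ _ hfloor hpos
        (Int.fract_lt_one _)
      exact ⟨C, hC, fun _ => h⟩
    · exact ⟨1, one_pos, fun h => absurd h hint⟩
  obtain ⟨C₂, hC₂, h₂⟩ :=
    FracHeat.exists_normCDini_le n k α hs₀ hs₁ _ _ hfloor (Int.fract_nonneg _) (Int.fract_lt_one _)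
  obtain ⟨C₃, hC₃, h₃⟩ : ∃ C : ℝ, 0 < C ∧ ∀ N : ℕ, e = N →
      ∀ f : FracHeat.SpaceTime n → ℝ, FracHeat.MemC k α 1 f →
        (FracHeat.MemCXLn N (1 / 2) (FracHeat.w₁ s f) ∧
          FracHeat.normCXLn N (1 / 2) (FracHeat.w₁ s f) ≤ C * FracHeat.normC k α 1 f) ∧
        (FracHeat.MemCLn N 0 (1 / 2) (FracHeat.w₁ s f) ∧
          FracHeat.normCLn N 0 (1 / 2) (FracHeat.w₁ s f) ≤ C * FracHeat.normC k α 1 f) := by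
    by_cases hint : ∃ N : ℕ, e = N
    · obtain ⟨N, hN⟩ := hint
      have hN0 : N ≠ 0 := by
        rintro rfl
        have : 0 < e := by positivity
        simp [hN] at this
      obtain ⟨N, rfl⟩ := Nat.exists_eq_succ_of_ne_zero hN0
      have hN' : (k : ℝ) + α + 2 * s = N + 1 := by rw [← he, hN, Nat.cast_succ]
      obtain ⟨C, hC, h⟩ := FracHeat.exists_normCXLn_le n k α hs₀ hs₁ N hN'
      obtain ⟨C', hC', h'⟩ := FracHeat.exists_normCLn_le n k α hs₀ hs₁ N hN'
      refine ⟨C + C', by positivity, fun M hM f hf => ?_⟩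
      obtain rfl : M = N + 1 := by exact_mod_cast hM.symm.trans hN
      have h0 : 0 ≤ FracHeat.normC k α 1 f := FracHeat.infNorm_nonneg fun _ _ h => h.1
      exact ⟨⟨(h f hf).1, (h f hf).2.trans (by gcongr; linarith)⟩,
        ⟨(h' f hf).1, (h' f hf).2.trans (by gcongr; linarith)⟩⟩
    · exact ⟨1, one_pos, fun N hN => absurd ⟨N, hN⟩ hint⟩
  refine ⟨C₁ + C₂ + C₃, by positivity, fun f _ => ⟨fun hf => ?_, fun hf => ?_⟩⟩
  · have h0 : 0 ≤ FracHeat.normC k α 1 f := FracHeat.infNorm_nonneg fun _ _ h => h.1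
    refine ⟨FracHeat.ae_integrableOn_integrand hs₀ hf.integrableOn _, fun hint => ?_,
      fun N hN _ => ?_, fun N hN _ => ?_⟩
    · exact ⟨(h₁ hint f hf).1, (h₁ hint f hf).2.trans (by gcongr; linarith)⟩
    · exact ⟨(h₃ N hN f hf).1.1, (h₃ N hN f hf).1.2.trans (by gcongr; linarith)⟩
    · exact ⟨(h₃ N hN f hf).2.1, (h₃ N hN f hf).2.2.trans (by gcongr; linarith)⟩
  · have h0 : 0 ≤ FracHeat.normCDini k α 1 f := FracHeat.infNorm_nonneg fun _ _ h => h.1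
    exact ⟨(h₂ f hf).1, (h₂ f hf).2.trans (by gcongr; linarith)⟩
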